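/- **Theorem (Equivalence Theorem).** Let $A,\delta,\rho\in\mathbb R$, $r:=A-\delta$, $\gamma>0$ with $\gamma\neq1$, $\varepsilon,\eta\ge0$, $0\le\tau<\infty$, $k_0>0$, and let $c_0\in L^1([-\tau,0);\mathbb R_+)$. Consider a population of identical households, indexed by a probability space $(\Omega,\mu)$ (for instance the continuum $[0,1]$). Each household chooses $c\in L^1_{loc}([0,\infty);\mathbb R_+)$ so as to maximize $$J=\int_0^\infty \frac{(c(t)-h(t))^{1-\gamma}}{1-\gamma}\,e^{-\rho t}\,dt,\qquad h(t)=\varepsilon\int_{t-\tau}^{t}\hat c(u)e^{\eta(u-t)}\,du ,$$ subject to $\dot k=(A-\delta)k-c$, $k(0)=k_0$, $k(t)\ge0$ for all $t\ge 0$, and $c(t)\ge h(t)$ for a.e. $t\ge0$. The felicity is $-\infty$ where $c<h$ and, if $\gamma>1$, also where $c=h$; a solution of the problem is required to have $-\infty<J<+\infty$. Here $\hat c=c_0$ on $[-\tau,0)$, and on $[0,\infty)$ either $\hat c=c$ is the household's own consumption (*internal habits*), or $\hat c=\bar c$ is the average consumption $\bar c(t)=\int_\Omega c_i(t)\,d\mu(i)$,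 which the household takes as given (*external habits*). An *equilibrium* is a profile $(c_i,k_i)_{i\in\Omega}$, with $(i,t)\mapsto c_i(t)$ integrable on $\Omega\times[0,T]$ for every $T$, such that for $\mu$-a.e. $i$ the pair $(c_i,k_i)$ solves the problem of household $i$ given $\bar c$. A consumption profile $(c_i)$ with this integrability and with $c_i\ge0$ a.e. is *feasible* if the solution of $\dot K=(A-\delta)K-\bar c$, $K(0)=k_0$, is nonnegative on $[0,\infty)$. A feasible profile is *Pareto optimal* if no feasible profile gives $\mu$-a.e. household at least the same utility $J$ and a non-null set of households a strictly larger one (habits being formed, under either specification, by the profile itself). Assume that 1. every real root $\lambda$ of $1=\varepsilon\int_{-\tau}^0 e^{(\lambda+\eta)u}\,du$ satisfies $\lambda<A-\delta$ (for instance $\varepsilon\le\eta$ and $A-\delta>0$); 2. $\rho>(A-\delta)(1-\gamma)$; 3. $\Bigl(1-\varepsilon\int_{-\tau}^0e^{(r+\eta)s}\,ds\Bigr)k_0>\int_{-\tau}^0e^{rs}\,\varepsilon\int_{-\tau}^{s}c_0(u-s)e^{\eta u}\,du\,ds$. Then there is a path $(c^*,k^*)$ on $[0,\infty)$ such that, both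 with internal and with external habits, the profile in which every household follows $(c^*,k^*)$ is an equilibrium; it is the only one, i.e. in every equilibrium $\mu$-a.e. household has $c_i=c^*$ a.e. on $[0,\infty)$ and $k_i=k^*$ on $[0,\infty)$; and it is Pareto optimal. In particular, internal and external habits lead to the same unique equilibrium path, and this path is Pareto optimal. -/

import Mathlib

open MeasureTheory Set Filter

noncomputable section

/-- Data of the AK economy with habits: technology `A`, depreciation `δ`, discount rate `ρ`,
curvature `γ`, habit intensity `ε`, persistence `η`, memory `τ`, initial capital `k₀` of each
household, and the common consumption history `c₀` (only its values on `[-τ, 0)` matter). -/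
structure HabitEconomy where
  A : ℝ
  δ : ℝ
  ρ : ℝ
  γ : ℝ
  ε : ℝ
  η : ℝ
  τ : ℝ
  k₀ : ℝ
  c₀ : ℝ → ℝ

/-- Whether habits are formed over the household's own past consumption or over the
economy-wide average past consumption. -/
inductive HabitRegime
  | internal
  | external

/-- The customary consumption path `ĉ`, given the economy-wide average consumption path `cbar`
and the household's own consumption path `c`. -/
def HabitRegime.customary : HabitRegime → (ℝ → ℝ) → (ℝ → ℝ) → (ℝ → ℝ)
  | .internal, _, c => c
  | .external, cbar, _ => cbar

namespace HabitEconomy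

/-- Concatenation of the history `c₀` with a path on `[0, ∞)`. -/
def concat (E : HabitEconomy) (c : ℝ → ℝ) (s : ℝ) : ℝ :=
  if s < 0 then E.c₀ s else c s

/-- `h(t) = ε ∫_{t-τ}^t ĉ(u) e^{η(u-t)} du`. -/
def habit (E : HabitEconomy) (chat : ℝ → ℝ) (t : ℝ) : ℝ :=
  E.ε * ∫ u in (t - E.τ)..t, E.concat chat u * Real.exp (E.η * (u - t))

/-- `x ^ (1 - γ) / (1 - γ)` for `x = c - h`, with value `-∞` for `x < 0`, and also at `x = 0`
when `γ > 1`. -/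
def felicity (E : HabitEconomy) (x : ℝ) : EReal :=
  if 0 < x ∨ (x = 0 ∧ E.γ < 1) then ((x ^ (1 - E.γ) / (1 - E.γ) : ℝ) : EReal) else ⊥

/-- Discounted felicity at time `t`. -/
def discountedFelicity (E : HabitEconomy) (c h : ℝ → ℝ) (t : ℝ) : EReal :=
  E.felicity (c t - h t) * ((Real.exp (-(E.ρ * t)) : ℝ) : EReal)

/-- `∫_0^∞ (c - h)^{1-γ} / (1-γ) e^{-ρt} dt` as an extended real number: the integral of the
positive part minus the integral of the negative part. If `c ≥ h` almost everywhere, one of the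
two parts vanishes; otherwise the value is `-∞` (in `EReal`, `⊤ - ⊤ = ⊥`). -/
def lifetimeUtility (E : HabitEconomy) (c h : ℝ → ℝ) : EReal :=
  ((∫⁻ t in Ici (0 : ℝ), (E.discountedFelicity c h t).toENNReal : ENNReal) : EReal) -
    ((∫⁻ t in Ici (0 : ℝ), (-E.discountedFelicity c h t).toENNReal : ENNReal) : EReal)

/-- `k` is the (absolutely continuous) solution on `[0, ∞)` of `k' = (A - δ) k - c`,
`k(0) = k₀`, written in integrated form. -/
def IsCapitalPath (E : HabitEconomy) (c k : ℝ → ℝ) : Prop :=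
  ContinuousOn k (Ici 0) ∧
    ∀ t, 0 ≤ t → k t = E.k₀ + ∫ u in (0 : ℝ)..t, ((E.A - E.δ) * k u - c u)

/-- The constraints of the household problem for a given path `h` of habits. -/
structure IsAdmissible (E : HabitEconomy) (h c k : ℝ → ℝ) : Prop where
  locallyIntegrable : LocallyIntegrableOn c (Ici 0)
  consumption_nonneg : ∀ᵐ t ∂volume.restrict (Ici (0 : ℝ)), 0 ≤ c t
  capitalPath : E.IsCapitalPath c k
  capital_nonneg : ∀ t, 0 ≤ t → 0 ≤ k t
  habit_le : ∀ᵐ t ∂volume.restrict (Ici (0 : ℝ)), h t ≤ c t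

/-- `(c, k)` solves the problem of a household which takes the average consumption `cbar` as given.
With internal habits `cbar` plays no role and this is the social planner problem. -/
structure IsHouseholdOptimal (E : HabitEconomy) (R : HabitRegime) (cbar c k : ℝ → ℝ) :
    Prop where
  admissible : E.IsAdmissible (E.habit (R.customary cbar c)) c k
  ne_bot : E.lifetimeUtility c (E.habit (R.customary cbar c)) ≠ ⊥
  ne_top : E.lifetimeUtility c (E.habit (R.customary cbar c)) ≠ ⊤
  le_of_admissible : ∀ c' k' : ℝ → ℝ, E.IsAdmissible (E.habit (R.customary cbar c')) c' k' →
    E.lifetimeUtility c' (E.habit (R.customary cbar c')) ≤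
      E.lifetimeUtility c (E.habit (R.customary cbar c))

/-- Average consumption of the population. -/
def averageConsumption {Ω : Type*} [MeasurableSpace Ω] (μ : Measure Ω) (c : Ω → ℝ → ℝ) (t : ℝ) : ℝ :=
  ∫ i, c i t ∂μ

/-- A profile of consumption paths for which the average is well defined and locally
integrable in time. -/
def IsIntegrableProfile {Ω : Type*} [MeasurableSpace Ω] (μ : Measure Ω) (c : Ω → ℝ → ℝ) : Prop :=
  ∀ T : ℝ, Integrable (Function.uncurry c) (μ.prod (volume.restrict (Icc (0 : ℝ) T)))

/-- Equilibrium of the economy with population `(Ω, μ)`: almost every household solves its own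
problem, taking as given the average consumption path which results from all the choices. -/
structure IsEquilibrium (E : HabitEconomy) (R : HabitRegime) {Ω : Type*} [MeasurableSpace Ω]
    (μ : Measure Ω) (c k : Ω → ℝ → ℝ) : Prop where
  integrable : IsIntegrableProfile μ c
  optimal : ∀ᵐ i ∂μ, E.IsHouseholdOptimal R (averageConsumption μ c) (c i) (k i)

/-- Profiles of nonnegative consumption paths that the aggregate resources of the economy
can sustain. The requirement `c ≥ h` enters through the value `-∞` of the utility. -/
structure IsFeasible (E : HabitEconomy) {Ω : Type*} [MeasurableSpace Ω] (μ : Measure Ω)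
    (c : Ω → ℝ → ℝ) : Prop where
  integrable : IsIntegrableProfile μ c
  nonneg : ∀ᵐ i ∂μ, ∀ᵐ t ∂volume.restrict (Ici (0 : ℝ)), 0 ≤ c i t
  resources : ∃ K : ℝ → ℝ, E.IsCapitalPath (averageConsumption μ c) K ∧ ∀ t, 0 ≤ t → 0 ≤ K t

/-- Lifetime utility of household `i` in the profile `c`. -/
def profileUtility (E : HabitEconomy) (R : HabitRegime) {Ω : Type*} [MeasurableSpace Ω]
    (μ : Measure Ω) (c : Ω → ℝ → ℝ) (i : Ω) : EReal :=
  E.lifetimeUtility (c i) (E.habit (R.customary (averageConsumption μ c) (c i)))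

/-- No feasible profile makes almost every household at least as well off and a non-null set of
households strictly better off. -/
def IsParetoOptimal (E : HabitEconomy) (R : HabitRegime) {Ω : Type*} [MeasurableSpace Ω]
    (μ : Measure Ω) (c : Ω → ℝ → ℝ) : Prop :=
  E.IsFeasible μ c ∧
    ¬ ∃ c' : Ω → ℝ → ℝ, E.IsFeasible μ c' ∧
      (∀ᵐ i ∂μ, E.profileUtility R μ c i ≤ E.profileUtility R μ c' i) ∧
      ∃ᵐ i ∂μ, E.profileUtility R μ c i < E.profileUtility R μ c' i

/-- `1 = ε ∫_{-τ}^0 e^{(lam+η)u} du`, the characteristic equation of `c = h[c]`. -/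
def IsCharacteristicRoot (E : HabitEconomy) (lam : ℝ) : Prop :=
  1 = E.ε * ∫ u in (-E.τ)..0, Real.exp ((lam + E.η) * u)

/-- The functional `G` at the initial structural state
`(k₀, s ↦ ε ∫_{-τ}^s c₀(u-s) e^{ηu} du)`. -/
def initialG (E : HabitEconomy) : ℝ :=
  (1 - E.ε * ∫ s in (-E.τ)..0, Real.exp ((E.A - E.δ + E.η) * s)) * E.k₀ -
    ∫ s in (-E.τ)..0, Real.exp ((E.A - E.δ) * s) *
      (E.ε * ∫ u in (-E.τ)..s, E.c₀ (u - s) * Real.exp (E.η * u))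

end HabitEconomy

end

/-! Everything is measured in present values at the net return `r = A - δ`. For nonnegative
consumption, `k ≥ 0` says that consumption has present value at most `k₀`. Discounted habits are the
convolution of discounted consumption, history included, with a nonnegative kernel of mass `D =
habitShare`. Hence `PV(h[c]) = D · PV(c) + H`, where `H = historyValue`, and the root condition
gives `D < 1`.

In terms of the excess `x = c - h`, both regimes become one problem: maximize power utility subject
to `PV(x) ≤ B`. Discounted marginal utility along `optimalExcess B` is a constant multiple of
`e^{-rt}`, so integrating the tangent line of the felicity bounds utility by an affine function of
`PV(x)`. Strict concavity makes the maximizer unique (`lifetimeUtility_le`, `ae_eq_optimalExcess`).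

With internal habits `B = (1 - D) k₀ - H = initialG`, and `c` is recovered from `c - h[c] = x` by a
contraction in `L¹` (`exists_consumption`, `consumption_unique`). With external habits `B = k₀ -
PV(h[c̄])` and every household chooses `h[c̄]` plus the same excess. So `c̄` is this common path, it
exhausts `k₀`, and therefore `B = initialG`: the path solves the internal equation
(`IsEquilibrium.ae_eq_of_external`).

For Pareto optimality, in any feasible profile the average of the individual `PV(x)` is at most
`initialG` under either regime. The affine utility bound, with the same multiplier for all, then
rules out an improvement. -/

/-! ### Concavity of power utility. -/

/-- Strict tangent line inequality for `y ↦ y ^ p / p` with `p < 1`, `p ≠ 0`. -/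
theorem rpow_div_lt_tangent_one {p y : ℝ} (hp0 : p ≠ 0) (hp1 : p < 1)
    (hy : 0 < y ∨ (y = 0 ∧ 0 < p)) (hy1 : y ≠ 1) : y ^ p / p < 1 / p + (y - 1) := by
  have hy0 : 0 ≤ y := by rcases hy with h | h <;> [exact h.le; exact h.1.ge]
  rcases lt_or_gt_of_ne hp0 with hp | hp
  · have hy : 0 < y := by
      rcases hy with h | h
      · exact h
      · exact absurd h.2 hp.le.not_gt
    -- For `p < 0`, Bernoulli at `1/y` with exponent `1 - p > 1`, multiplied by `y`, gives `1 + p (y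
    -- - 1) < y ^ p`; dividing by `p` reverses it.
    have h1 := one_add_mul_self_lt_rpow_one_add (s := y⁻¹ - 1)
      (by linarith [inv_pos.2 hy]) (by
        intro h
        exact hy1 (by rw [← inv_inv y, sub_eq_zero.1 h, inv_one])) (p := 1 - p) (by linarith)
    rw [add_sub_cancel, Real.inv_rpow hy0, Real.rpow_sub hy, Real.rpow_one] at h1
    have h2 := mul_lt_mul_of_pos_left h1 hy
    have h3 : y * (y / y ^ p)⁻¹ = y ^ p := by
      have := (Real.rpow_pos_of_pos hy p).ne'
      field_simp
    have h4 : y * (1 + (1 - p) * (y⁻¹ - 1)) = 1 + p * (y - 1) := by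
      field_simp
      ring
    rw [h3, h4] at h2
    rw [div_lt_iff_of_neg hp, add_mul, one_div, inv_mul_cancel₀ hp0]
    linarith
  · have h1 := rpow_one_add_lt_one_add_mul_self (s := y - 1) (by linarith)
      (sub_ne_zero.2 hy1) hp hp1
    rw [add_sub_cancel] at h1
    rw [div_lt_iff₀ hp, add_mul, one_div, inv_mul_cancel₀ hp0]
    linarith

/-- Strict tangent line inequality at `a` for the power utility. -/
theorem power_utility_lt_tangent {γ a x : ℝ} (hγ : 0 < γ) (hγ1 : γ ≠ 1) (ha : 0 < a)
    (hx : 0 < x ∨ (x = 0 ∧ γ < 1)) (hxa : x ≠ a) :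
    x ^ (1 - γ) / (1 - γ) < a ^ (1 - γ) / (1 - γ) + a ^ (-γ) * (x - a) := by
  have hx0 : 0 ≤ x := by rcases hx with h | h <;> [exact h.le; exact h.1.ge]
  -- Homogeneity reduces the tangent at `a` to the tangent at `1` through `y = x / a`.
  have h := rpow_div_lt_tangent_one (p := 1 - γ) (y := x / a) (sub_ne_zero.2 hγ1.symm)
    (by linarith) (by
      rcases hx with h | h
      · exact Or.inl (div_pos h ha)
      · exact Or.inr ⟨by simp [h.1], by linarith [h.2]⟩)
    (by rwa [Ne, div_eq_one_iff_eq ha.ne'])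
  have hap := Real.rpow_pos_of_pos ha (1 - γ)
  have h2 := mul_lt_mul_of_pos_left h hap
  have h3 : a ^ (1 - γ) = a ^ (-γ) * a := by
    rw [sub_eq_add_neg, add_comm, Real.rpow_add ha, Real.rpow_one]
  rw [Real.div_rpow hx0 ha.le] at h2
  calc x ^ (1 - γ) / (1 - γ) = a ^ (1 - γ) * (x ^ (1 - γ) / a ^ (1 - γ) / (1 - γ)) := by
        field_simp
    _ < _ := h2
    _ = _ := by
        rw [mul_add, mul_one_div]
        congr 1
        rw [h3]
        field_simp

theorem power_utility_le_tangent {γ a x : ℝ} (hγ : 0 < γ) (hγ1 : γ ≠ 1) (ha : 0 < a)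
    (hx : 0 < x ∨ (x = 0 ∧ γ < 1)) :
    x ^ (1 - γ) / (1 - γ) ≤ a ^ (1 - γ) / (1 - γ) + a ^ (-γ) * (x - a) := by
  by_cases hxa : x = a
  · simp [hxa]
  · exact (power_utility_lt_tangent hγ hγ1 ha hx hxa).le

/-! ### Lifetime utility as an ordinary integral. -/

namespace HabitEconomy

variable (E : HabitEconomy)

/-- The real integrand of the lifetime utility. -/
noncomputable def realFelicity (x t : ℝ) : ℝ :=
  x ^ (1 - E.γ) / (1 - E.γ) * Real.exp (-(E.ρ * t))

variable {E}

theorem discountedFelicity_eq_coe {c h : ℝ → ℝ} {t : ℝ}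
    (ht : 0 < c t - h t ∨ (c t - h t = 0 ∧ E.γ < 1)) :
    E.discountedFelicity c h t = (E.realFelicity (c t - h t) t : EReal) := by
  rw [discountedFelicity, felicity, if_pos ht, realFelicity, EReal.coe_mul]

theorem discountedFelicity_eq_bot {c h : ℝ → ℝ} {t : ℝ}
    (ht : ¬ (0 < c t - h t ∨ (c t - h t = 0 ∧ E.γ < 1))) :
    E.discountedFelicity c h t = ⊥ := by
  rw [discountedFelicity, felicity, if_neg ht, EReal.bot_mul_coe_of_pos (Real.exp_pos _)]

theorem lifetimeUtility_eq_coe {c h : ℝ → ℝ}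
    (hdom : ∀ᵐ t ∂volume.restrict (Ici (0 : ℝ)), 0 < c t - h t ∨ (c t - h t = 0 ∧ E.γ < 1))
    (hint : IntegrableOn (fun t => E.realFelicity (c t - h t) t) (Ici 0)) :
    E.lifetimeUtility c h =
      ((∫ t in Ici (0 : ℝ), E.realFelicity (c t - h t) t : ℝ) : EReal) := by
  have h1 : ∫⁻ t in Ici (0 : ℝ), (E.discountedFelicity c h t).toENNReal =
      ∫⁻ t in Ici (0 : ℝ), ENNReal.ofReal (E.realFelicity (c t - h t) t) := by
    refine lintegral_congr_ae ?_
    filter_upwards [hdom] with t ht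
    rw [discountedFelicity_eq_coe ht, EReal.real_coe_toENNReal]
  have h2 : ∫⁻ t in Ici (0 : ℝ), (-E.discountedFelicity c h t).toENNReal =
      ∫⁻ t in Ici (0 : ℝ), ENNReal.ofReal (-E.realFelicity (c t - h t) t) := by
    refine lintegral_congr_ae ?_
    filter_upwards [hdom] with t ht
    rw [discountedFelicity_eq_coe ht, ← EReal.coe_neg, EReal.real_coe_toENNReal]
  rw [lifetimeUtility, h1, h2, integral_eq_lintegral_pos_part_sub_lintegral_neg_part hint,
    EReal.coe_sub, EReal.coe_ennreal_toReal, EReal.coe_ennreal_toReal]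
  · exact hint.neg.lintegral_lt_top.ne
  · exact hint.lintegral_lt_top.ne

/-- In `EReal`, subtracting `⊤` gives `⊥` even from `⊤`, so no control of the positive part is
needed. -/
theorem lintegral_neg_ne_top_of_lifetimeUtility_ne_bot {c h : ℝ → ℝ}
    (hU : E.lifetimeUtility c h ≠ ⊥) :
    ∫⁻ t in Ici (0 : ℝ), (-E.discountedFelicity c h t).toENNReal ≠ ⊤ := by
  intro htop
  apply hU
  rw [lifetimeUtility, htop, EReal.coe_ennreal_top, EReal.sub_top]

/-- Where felicity is `-∞` the negative part is `⊤`, and a finite integral allows this only on a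
null set. -/
theorem ae_domain_of_lifetimeUtility_ne_bot {c h : ℝ → ℝ}
    (hm : AEMeasurable (fun t => c t - h t) (volume.restrict (Ici (0 : ℝ))))
    (hU : E.lifetimeUtility c h ≠ ⊥) :
    ∀ᵐ t ∂volume.restrict (Ici (0 : ℝ)), 0 < c t - h t ∨ (c t - h t = 0 ∧ E.γ < 1) := by
  have hfin := lintegral_neg_ne_top_of_lifetimeUtility_ne_bot hU
  set S : Set ℝ := {x | 0 < x ∨ (x = 0 ∧ E.γ < 1)} with hS
  have hSm : MeasurableSet S :=
    (measurableSet_Ioi (a := (0 : ℝ))).union ((measurableSet_singleton (0 : ℝ)).inter (.const _))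
  have hg : Measurable (fun x : ℝ => (Sᶜ).indicator (fun _ => (⊤ : ENNReal)) x) :=
    measurable_const.indicator hSm.compl
  -- This minorant is a measurable function of `c - h`, which makes the a.e. finiteness argument
  -- available without measurability of the `EReal` felicity.
  have hle : ∫⁻ t in Ici (0 : ℝ), (Sᶜ).indicator (fun _ => (⊤ : ENNReal)) (c t - h t) ≤
      ∫⁻ t in Ici (0 : ℝ), (-E.discountedFelicity c h t).toENNReal := by
    refine lintegral_mono fun t => ?_
    by_cases ht : c t - h t ∈ S
    · simp [ht]
    · rw [discountedFelicity_eq_bot ht]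
      simp
  have h3 := ae_lt_top' (hg.comp_aemeasurable hm) (ne_top_of_le_ne_top hfin hle)
  filter_upwards [h3] with t ht
  by_contra hcon
  have : c t - h t ∈ Sᶜ := hcon
  simp [this] at ht

/-- If utility is not `-∞` and the integrand has an integrable majorant, then the utility is
an ordinary integral. -/
theorem integrableOn_realFelicity {c h b : ℝ → ℝ}
    (hm : AEMeasurable (fun t => c t - h t) (volume.restrict (Ici (0 : ℝ))))
    (hU : E.lifetimeUtility c h ≠ ⊥) (hb : IntegrableOn b (Ici 0))
    (hle : ∀ᵐ t ∂volume.restrict (Ici (0 : ℝ)), E.realFelicity (c t - h t) t ≤ b t) :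
    IntegrableOn (fun t => E.realFelicity (c t - h t) t) (Ici 0) := by
  have hdom := ae_domain_of_lifetimeUtility_ne_bot hm hU
  have hmeas : AEMeasurable (fun t => E.realFelicity (c t - h t) t)
      (volume.restrict (Ici (0 : ℝ))) := by
    unfold realFelicity
    exact ((hm.pow_const _).div_const _).mul (by fun_prop)
  -- Utility other than `-∞` controls the negative part; the majorant `b` controls the positive
  -- part.
  have hneg : Integrable (fun t => max (-E.realFelicity (c t - h t) t) 0)
      (volume.restrict (Ici (0 : ℝ))) := by
    refine ⟨(hmeas.neg.max aemeasurable_const).aestronglyMeasurable, ?_⟩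
    refine (hasFiniteIntegral_iff_ofReal (Eventually.of_forall fun _ => le_max_right _ _)).2 ?_
    refine lt_of_le_of_lt (lintegral_mono_ae ?_)
      (lintegral_neg_ne_top_of_lifetimeUtility_ne_bot hU).lt_top
    filter_upwards [hdom] with t ht
    rw [discountedFelicity_eq_coe ht, ← EReal.coe_neg, EReal.real_coe_toENNReal]
    simp
  refine (hb.norm.add hneg).mono' hmeas.aestronglyMeasurable ?_
  filter_upwards [hle] with t ht
  simp only [Pi.add_apply, Real.norm_eq_abs]
  refine abs_le.2 ⟨?_, ?_⟩
  · linarith [le_max_left (-E.realFelicity (c t - h t) t) 0, abs_nonneg (b t)]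
  · linarith [le_max_right (-E.realFelicity (c t - h t) t) 0, le_abs_self (b t)]

end HabitEconomy

/-! ### Present values and the maximization of utility under a present value budget. -/

namespace HabitEconomy

variable (E : HabitEconomy)

/-- The net return `r = A - δ` on capital. -/
noncomputable abbrev netReturn : ℝ := E.A - E.δ

/-- Integrability on `[0, ∞)` of a path discounted at the net return. -/
def HasPresentValue (f : ℝ → ℝ) : Prop :=
  IntegrableOn (fun t => Real.exp (-(E.netReturn * t)) * f t) (Ici 0)

/-- The present value `∫_0^∞ e^{-rt} f(t) dt`. -/
noncomputable def presentValue (f : ℝ → ℝ) : ℝ :=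
  ∫ t in Ici (0 : ℝ), Real.exp (-(E.netReturn * t)) * f t

/-- The growth rate of consumption in excess of habits. -/
noncomputable def growth : ℝ := (E.netReturn - E.ρ) / E.γ

/-- The utility-maximizing excess consumption of present value `B`. -/
noncomputable def optimalExcess (B t : ℝ) : ℝ :=
  (E.netReturn - E.growth) * B * Real.exp (E.growth * t)

/-- The utility of `optimalExcess`. -/
noncomputable def optimalUtility (B : ℝ) : ℝ :=
  ∫ t in Ici (0 : ℝ), E.realFelicity (E.optimalExcess B t) t

variable {E}

theorem HasPresentValue.add {f g : ℝ → ℝ} (hf : E.HasPresentValue f) (hg : E.HasPresentValue g) :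
    E.HasPresentValue (fun t => f t + g t) := by
  unfold HasPresentValue
  simp only [mul_add]
  exact Integrable.add hf hg

theorem HasPresentValue.sub {f g : ℝ → ℝ} (hf : E.HasPresentValue f) (hg : E.HasPresentValue g) :
    E.HasPresentValue (fun t => f t - g t) := by
  unfold HasPresentValue
  simp only [mul_sub]
  exact Integrable.sub hf hg

theorem HasPresentValue.congr {f g : ℝ → ℝ} (hf : E.HasPresentValue f)
    (h : f =ᵐ[volume.restrict (Ici (0 : ℝ))] g) : E.HasPresentValue g := by
  refine Integrable.congr hf ?_
  filter_upwards [h] with t ht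
  rw [ht]

theorem presentValue_congr {f g : ℝ → ℝ}
    (h : f =ᵐ[volume.restrict (Ici (0 : ℝ))] g) : E.presentValue f = E.presentValue g := by
  refine integral_congr_ae ?_
  filter_upwards [h] with t ht
  rw [ht]

theorem presentValue_add {f g : ℝ → ℝ} (hf : E.HasPresentValue f) (hg : E.HasPresentValue g) :
    E.presentValue (fun t => f t + g t) = E.presentValue f + E.presentValue g := by
  unfold presentValue
  simp only [mul_add]
  exact integral_add hf hg

theorem presentValue_sub {f g : ℝ → ℝ} (hf : E.HasPresentValue f) (hg : E.HasPresentValue g) :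
    E.presentValue (fun t => f t - g t) = E.presentValue f - E.presentValue g := by
  unfold presentValue
  simp only [mul_sub]
  exact integral_sub hf hg

theorem HasPresentValue.aemeasurable {f : ℝ → ℝ} (hf : E.HasPresentValue f) :
    AEMeasurable f (volume.restrict (Ici (0 : ℝ))) := by
  have h : f = fun t => Real.exp (E.netReturn * t) * (Real.exp (-(E.netReturn * t)) * f t) := by
    funext t
    rw [← mul_assoc, ← Real.exp_add, add_neg_cancel, Real.exp_zero, one_mul]
  rw [h]
  exact AEMeasurable.mul (by fun_prop) (Integrable.aemeasurable hf)

theorem HasPresentValue.locallyIntegrableOn {f : ℝ → ℝ} (hf : E.HasPresentValue f) :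
    LocallyIntegrableOn f (Ici 0) := by
  have h : f = fun t => Real.exp (E.netReturn * t) * (Real.exp (-(E.netReturn * t)) * f t) := by
    funext t
    rw [← mul_assoc, ← Real.exp_add, add_neg_cancel, Real.exp_zero, one_mul]
  rw [h]
  exact (IntegrableOn.locallyIntegrableOn hf).continuousOn_mul (by fun_prop)
    isClosed_Ici.isLocallyClosed

/-- Since `r - g = (ρ - r (1 - γ)) / γ`, this is the discounting hypothesis; it makes
`optimalExcess` have a finite present value. -/
theorem growth_lt_netReturn (hγ : 0 < E.γ) (hρ : E.netReturn * (1 - E.γ) < E.ρ) :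
    E.growth < E.netReturn := by
  rw [growth, div_lt_iff₀ hγ]
  linarith

theorem optimalExcess_pos (hγ : 0 < E.γ) (hρ : E.netReturn * (1 - E.γ) < E.ρ) {B : ℝ}
    (hB : 0 < B) (t : ℝ) : 0 < E.optimalExcess B t :=
  mul_pos (mul_pos (sub_pos.2 (growth_lt_netReturn hγ hρ)) hB) (Real.exp_pos _)

theorem exp_mul_optimalExcess (B t : ℝ) :
    Real.exp (-(E.netReturn * t)) * E.optimalExcess B t =
      (E.netReturn - E.growth) * B * Real.exp ((E.growth - E.netReturn) * t) := by
  rw [optimalExcess, mul_left_comm, ← Real.exp_add]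
  ring_nf

theorem hasPresentValue_optimalExcess (hγ : 0 < E.γ) (hρ : E.netReturn * (1 - E.γ) < E.ρ)
    (B : ℝ) : E.HasPresentValue (E.optimalExcess B) := by
  have hg := growth_lt_netReturn hγ hρ
  unfold HasPresentValue
  simp only [exp_mul_optimalExcess]
  rw [integrableOn_Ici_iff_integrableOn_Ioi]
  exact (integrableOn_exp_mul_Ioi (sub_neg.2 hg) 0).const_mul _

theorem presentValue_optimalExcess (hγ : 0 < E.γ) (hρ : E.netReturn * (1 - E.γ) < E.ρ)
    (B : ℝ) : E.presentValue (E.optimalExcess B) = B := by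
  have hg := growth_lt_netReturn hγ hρ
  unfold presentValue
  simp only [exp_mul_optimalExcess]
  rw [integral_Ici_eq_integral_Ioi, integral_const_mul, integral_exp_mul_Ioi (sub_neg.2 hg)]
  have : E.growth - E.netReturn ≠ 0 := (sub_neg.2 hg).ne
  rw [mul_zero, Real.exp_zero]
  field_simp
  ring

/-- Discounted marginal utility along `optimalExcess` declines at the rate of the net return. -/
theorem marginal_optimalExcess (hγ : 0 < E.γ) (hρ : E.netReturn * (1 - E.γ) < E.ρ) {B : ℝ}
    (hB : 0 < B) (t : ℝ) :
    E.optimalExcess B t ^ (-E.γ) * Real.exp (-(E.ρ * t)) =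
      ((E.netReturn - E.growth) * B) ^ (-E.γ) * Real.exp (-(E.netReturn * t)) := by
  have ha := mul_pos (sub_pos.2 (growth_lt_netReturn hγ hρ)) hB
  rw [optimalExcess, Real.mul_rpow ha.le (Real.exp_pos _).le, ← Real.exp_mul, mul_assoc,
    ← Real.exp_add]
  congr 2
  have : E.growth * E.γ = E.netReturn - E.ρ := div_mul_cancel₀ _ hγ.ne'
  linear_combination (-t) * this

/-- Felicity is marginal utility times excess over `1 - γ`. As discounted marginal utility is
proportional to `e^{-rt}`, integrability of utility reduces to existence of the present value. -/
theorem realFelicity_optimalExcess (hγ : 0 < E.γ) (hρ : E.netReturn * (1 - E.γ) < E.ρ) {B : ℝ}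
    (hB : 0 < B) (t : ℝ) :
    E.realFelicity (E.optimalExcess B t) t =
      ((E.netReturn - E.growth) * B) ^ (-E.γ) / (1 - E.γ) *
        (Real.exp (-(E.netReturn * t)) * E.optimalExcess B t) := by
  have h := marginal_optimalExcess hγ hρ hB t
  have hx := optimalExcess_pos hγ hρ hB t
  have h3 : E.optimalExcess B t ^ (1 - E.γ) =
      E.optimalExcess B t ^ (-E.γ) * E.optimalExcess B t := by
    rw [sub_eq_add_neg, add_comm, Real.rpow_add hx, Real.rpow_one]
  rw [realFelicity, h3]
  linear_combination E.optimalExcess B t / (1 - E.γ) * h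

theorem integrableOn_realFelicity_optimalExcess (hγ : 0 < E.γ)
    (hρ : E.netReturn * (1 - E.γ) < E.ρ) {B : ℝ} (hB : 0 < B) :
    IntegrableOn (fun t => E.realFelicity (E.optimalExcess B t) t) (Ici 0) := by
  simp only [realFelicity_optimalExcess hγ hρ hB]
  exact Integrable.const_mul (hasPresentValue_optimalExcess hγ hρ B) _

theorem lifetimeUtility_of_ae_eq_optimalExcess (hγ : 0 < E.γ)
    (hρ : E.netReturn * (1 - E.γ) < E.ρ) {B : ℝ} (hB : 0 < B) {c h : ℝ → ℝ}
    (hx : (fun t => c t - h t) =ᵐ[volume.restrict (Ici (0 : ℝ))] E.optimalExcess B) :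
    E.lifetimeUtility c h = (E.optimalUtility B : EReal) := by
  have hx' : (fun t => E.realFelicity (c t - h t) t) =ᵐ[volume.restrict (Ici (0 : ℝ))]
      fun t => E.realFelicity (E.optimalExcess B t) t := by
    filter_upwards [hx] with t ht
    rw [ht]
  rw [lifetimeUtility_eq_coe, optimalUtility, integral_congr_ae hx']
  · filter_upwards [hx] with t ht
    rw [ht]
    exact Or.inl (optimalExcess_pos hγ hρ hB t)
  · exact Integrable.congr (integrableOn_realFelicity_optimalExcess hγ hρ hB) hx'.symm

section Bound

variable {B : ℝ} {c h : ℝ → ℝ}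

/-- The tangent line majorant of discounted felicity along `optimalExcess`. -/
noncomputable def tangentMajorant (E : HabitEconomy) (B : ℝ) (x : ℝ → ℝ) (t : ℝ) : ℝ :=
  E.realFelicity (E.optimalExcess B t) t + ((E.netReturn - E.growth) * B) ^ (-E.γ) *
    (Real.exp (-(E.netReturn * t)) * (x t - E.optimalExcess B t))

theorem tangentMajorant_eq
    (hγ : 0 < E.γ) (hρ : E.netReturn * (1 - E.γ) < E.ρ) (hB : 0 < B)
    (x : ℝ → ℝ) (t : ℝ) :
    E.tangentMajorant B x t = (E.optimalExcess B t ^ (1 - E.γ) / (1 - E.γ) +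
      E.optimalExcess B t ^ (-E.γ) * (x t - E.optimalExcess B t)) * Real.exp (-(E.ρ * t)) := by
  have h := marginal_optimalExcess hγ hρ hB t
  rw [tangentMajorant, realFelicity]
  linear_combination (-(x t - E.optimalExcess B t)) * h

theorem integrableOn_tangentMajorant
    (hγ : 0 < E.γ) (hρ : E.netReturn * (1 - E.γ) < E.ρ) (hB : 0 < B)
    {x : ℝ → ℝ} (hx : E.HasPresentValue x) :
    IntegrableOn (E.tangentMajorant B x) (Ici 0) :=
  Integrable.add (integrableOn_realFelicity_optimalExcess hγ hρ hB)
    (Integrable.const_mul (hx.sub (hasPresentValue_optimalExcess hγ hρ B)) _)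

/-- The slope of the majorant is a constant times `e^{-rt}`, so its integral sees `x` only through
the present value; the constant is the multiplier of the budget. -/
theorem integral_tangentMajorant
    (hγ : 0 < E.γ) (hρ : E.netReturn * (1 - E.γ) < E.ρ) (hB : 0 < B)
    {x : ℝ → ℝ} (hx : E.HasPresentValue x) :
    ∫ t in Ici (0 : ℝ), E.tangentMajorant B x t =
      E.optimalUtility B + ((E.netReturn - E.growth) * B) ^ (-E.γ) * (E.presentValue x - B) := by
  have h0 := hasPresentValue_optimalExcess hγ hρ B
  have h1 := presentValue_sub hx h0
  rw [presentValue_optimalExcess hγ hρ] at h1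
  rw [← h1, presentValue, ← integral_const_mul]
  exact integral_add (integrableOn_realFelicity_optimalExcess hγ hρ hB)
    (Integrable.const_mul (hx.sub h0) _)

theorem realFelicity_le_tangentMajorant
    (hγ : 0 < E.γ) (hγ1 : E.γ ≠ 1) (hρ : E.netReturn * (1 - E.γ) < E.ρ) (hB : 0 < B)
    {x : ℝ → ℝ} {t : ℝ}
    (ht : 0 < x t ∨ (x t = 0 ∧ E.γ < 1)) :
    E.realFelicity (x t) t ≤ E.tangentMajorant B x t := by
  rw [tangentMajorant_eq hγ hρ hB, realFelicity]
  exact mul_le_mul_of_nonneg_right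
    (power_utility_le_tangent hγ hγ1 (optimalExcess_pos hγ hρ hB t) ht) (Real.exp_pos _).le

theorem eq_optimalExcess_of_realFelicity_eq
    (hγ : 0 < E.γ) (hγ1 : E.γ ≠ 1) (hρ : E.netReturn * (1 - E.γ) < E.ρ) (hB : 0 < B)
    {x : ℝ → ℝ} {t : ℝ}
    (ht : 0 < x t ∨ (x t = 0 ∧ E.γ < 1))
    (heq : E.realFelicity (x t) t = E.tangentMajorant B x t) : x t = E.optimalExcess B t := by
  by_contra hne
  rw [tangentMajorant_eq hγ hρ hB, realFelicity] at heq
  exact (mul_lt_mul_of_pos_right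
    (power_utility_lt_tangent hγ hγ1 (optimalExcess_pos hγ hρ hB t) ht hne)
      (Real.exp_pos (-(E.ρ * t)))).ne heq

/-- Utility is bounded by its linearization in the present value of excess consumption. -/
theorem lifetimeUtility_le
    (hγ : 0 < E.γ) (hγ1 : E.γ ≠ 1) (hρ : E.netReturn * (1 - E.γ) < E.ρ) (hB : 0 < B)
    (hx : E.HasPresentValue (fun t => c t - h t)) :
    E.lifetimeUtility c h ≤ ((E.optimalUtility B + ((E.netReturn - E.growth) * B) ^ (-E.γ) *
      (E.presentValue (fun t => c t - h t) - B) : ℝ) : EReal) := by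
  by_cases hU : E.lifetimeUtility c h = ⊥
  · rw [hU]
    exact bot_le
  have hdom := ae_domain_of_lifetimeUtility_ne_bot hx.aemeasurable hU
  have hle := hdom.mono fun t ht =>
    realFelicity_le_tangentMajorant hγ hγ1 hρ hB (x := fun t => c t - h t) ht
  have hb := integrableOn_tangentMajorant hγ hρ hB hx
  have hint := integrableOn_realFelicity hx.aemeasurable hU hb hle
  rw [lifetimeUtility_eq_coe hdom hint, ← integral_tangentMajorant hγ hρ hB hx,
    EReal.coe_le_coe_iff]
  exact integral_mono_ae hint hb hle

/-- Within the present value budget `B`, only `optimalExcess` attains `optimalUtility`. -/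
theorem ae_eq_optimalExcess
    (hγ : 0 < E.γ) (hγ1 : E.γ ≠ 1) (hρ : E.netReturn * (1 - E.γ) < E.ρ) (hB : 0 < B)
    (hx : E.HasPresentValue (fun t => c t - h t))
    (hbudget : E.presentValue (fun t => c t - h t) ≤ B)
    (hU : (E.optimalUtility B : EReal) ≤ E.lifetimeUtility c h) :
    (fun t => c t - h t) =ᵐ[volume.restrict (Ici (0 : ℝ))] E.optimalExcess B := by
  have hbot : E.lifetimeUtility c h ≠ ⊥ := by
    intro h0
    rw [h0, le_bot_iff] at hU
    exact EReal.coe_ne_bot _ hU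
  have hdom := ae_domain_of_lifetimeUtility_ne_bot hx.aemeasurable hbot
  have hle := hdom.mono fun t ht =>
    realFelicity_le_tangentMajorant hγ hγ1 hρ hB (x := fun t => c t - h t) ht
  have hb := integrableOn_tangentMajorant hγ hρ hB hx
  have hint := integrableOn_realFelicity hx.aemeasurable hbot hb hle
  rw [lifetimeUtility_eq_coe hdom hint, EReal.coe_le_coe_iff] at hU
  have ha := Real.rpow_pos_of_pos (mul_pos (sub_pos.2 (growth_lt_netReturn hγ hρ)) hB) (-E.γ)
  have htan := integral_tangentMajorant hγ hρ hB hx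
  have h1 := mul_nonneg ha.le (sub_nonneg.2 hbudget)
  -- The budget bounds the integral of the majorant by `optimalUtility B`, so both integrals agree
  -- and the pointwise inequality is an equality a.e.
  have heq := (integral_eq_iff_of_ae_le hint hb hle).1
    (le_antisymm (integral_mono_ae hint hb hle) (by rw [htan]; linarith))
  filter_upwards [hdom, heq] with t ht1 ht2
  exact eq_optimalExcess_of_realFelicity_eq hγ hγ1 hρ hB (x := fun t => c t - h t) ht1 ht2

end Bound

end HabitEconomy

/-! ### Capital paths and the intertemporal budget constraint. -/

theorem locallyIntegrableOn_Ici_iff {f : ℝ → ℝ} :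
    LocallyIntegrableOn f (Ici 0) ↔ ∀ T, IntegrableOn f (Icc 0 T) := by
  rw [locallyIntegrableOn_iff isClosed_Ici.isLocallyClosed]
  refine ⟨fun h T => h _ Icc_subset_Ici_self isCompact_Icc, fun h K hK hKc => ?_⟩
  obtain ⟨T, hT⟩ := hKc.bddAbove
  exact (h T).mono_set fun t ht => ⟨hK ht, hT ht⟩

theorem MeasureTheory.LocallyIntegrableOn.intervalIntegrable_zero {f : ℝ → ℝ}
    (hf : LocallyIntegrableOn f (Ici 0)) {t : ℝ} (ht : 0 ≤ t) :
    IntervalIntegrable f volume 0 t :=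
  (intervalIntegrable_iff_integrableOn_Icc_of_le ht).2 (locallyIntegrableOn_Ici_iff.1 hf t)

theorem absolutelyContinuousOnInterval_exp_mul (a s t : ℝ) :
    AbsolutelyContinuousOnInterval (fun u => Real.exp (a * u)) s t := by
  refine ContDiffOn.absolutelyContinuousOnInterval ?_
  exact (ContDiff.contDiffOn (by fun_prop))

theorem absolutelyContinuousOnInterval_const_add_integral {f : ℝ → ℝ} {t : ℝ} (b : ℝ)
    (hf : IntervalIntegrable f volume 0 t) :
    AbsolutelyContinuousOnInterval (fun s => b + ∫ u in (0 : ℝ)..s, f u) 0 t := by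
  have h1 : AbsolutelyContinuousOnInterval (fun _ : ℝ => b) 0 t :=
    (ContDiff.contDiffOn contDiff_const).absolutelyContinuousOnInterval
  exact h1.add (hf.absolutelyContinuousOnInterval_intervalIntegral (by simp))

/-- Integration by parts of an exponential against a primitive. -/
theorem integral_exp_mul_primitive {f : ℝ → ℝ} {t : ℝ} (a b : ℝ)
    (hf : IntervalIntegrable f volume 0 t) :
    ∫ s in (0 : ℝ)..t, (a * (Real.exp (a * s) * (b + ∫ u in (0 : ℝ)..s, f u)) +
        Real.exp (a * s) * f s) =
      Real.exp (a * t) * (b + ∫ u in (0 : ℝ)..t, f u) - b := by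
  -- As `f` is merely integrable, its primitive is only absolutely continuous and the product rule
  -- holds only a.e.
  have h := (absolutelyContinuousOnInterval_exp_mul a 0 t).integral_deriv_mul_eq_sub
    (absolutelyContinuousOnInterval_const_add_integral b hf)
  simp only [mul_zero, Real.exp_zero, intervalIntegral.integral_same, add_zero, one_mul] at h
  rw [← h]
  refine intervalIntegral.integral_congr_ae ?_
  filter_upwards [hf.ae_hasDerivAt_integral] with s hs hst
  have h1 := ((hs (uIoc_subset_uIcc hst) 0 (by simp)).const_add b).deriv
  have h2 : deriv (fun u => Real.exp (a * u)) s = a * Real.exp (a * s) := by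
    have := ((hasDerivAt_id s).const_mul a).exp.deriv
    simpa [mul_comm] using this
  rw [h1, h2]
  ring

namespace HabitEconomy

variable {E : HabitEconomy}

/-- Variation of constants: in `e^{-rt} k` the return on capital cancels and only discounted
consumption remains. -/
theorem IsCapitalPath.eq {c k : ℝ → ℝ} (hc : LocallyIntegrableOn c (Ici 0))
    (hk : E.IsCapitalPath c k) {t : ℝ} (ht : 0 ≤ t) :
    Real.exp (-(E.netReturn * t)) * k t =
      E.k₀ - ∫ u in (0 : ℝ)..t, Real.exp (-(E.netReturn * u)) * c u := by
  have hcI := hc.intervalIntegrable_zero ht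
  have hkI : IntervalIntegrable k volume 0 t :=
    (hk.1.mono (by rw [uIcc_of_le ht]; exact Icc_subset_Ici_self)).intervalIntegrable
  have h := integral_exp_mul_primitive (-E.netReturn) E.k₀ ((hkI.const_mul E.netReturn).sub hcI)
  rw [← hk.2 t ht] at h
  have h2 : ∫ s in (0 : ℝ)..t, (-E.netReturn * (Real.exp (-E.netReturn * s) *
        (E.k₀ + ∫ u in (0 : ℝ)..s, (E.netReturn * k u - c u))) +
        Real.exp (-E.netReturn * s) * (E.netReturn * k s - c s)) =
      ∫ s in (0 : ℝ)..t, -(Real.exp (-(E.netReturn * s)) * c s) := by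
    refine intervalIntegral.integral_congr fun s hs => ?_
    rw [uIcc_of_le ht] at hs
    have h3 := hk.2 s hs.1
    change -E.netReturn * (Real.exp (-E.netReturn * s) *
      (E.k₀ + ∫ u in (0 : ℝ)..s, (E.netReturn * k u - c u))) +
        Real.exp (-E.netReturn * s) * (E.netReturn * k s - c s) =
          -(Real.exp (-(E.netReturn * s)) * c s)
    rw [← h3, neg_mul E.netReturn s]
    ring
  rw [h2, intervalIntegral.integral_neg, neg_mul] at h
  linarith

variable (E) in
/-- The capital path which finances the consumption path `c`. -/
noncomputable def capital (c : ℝ → ℝ) (t : ℝ) : ℝ :=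
  Real.exp (E.netReturn * t) * (E.k₀ - ∫ u in (0 : ℝ)..t, Real.exp (-(E.netReturn * u)) * c u)

theorem IsCapitalPath.eqOn_capital {c k : ℝ → ℝ} (hc : LocallyIntegrableOn c (Ici 0))
    (hk : E.IsCapitalPath c k) : EqOn k (E.capital c) (Ici 0) := by
  intro t ht
  rw [capital, ← hk.eq hc ht, ← mul_assoc, ← Real.exp_add, add_neg_cancel, Real.exp_zero, one_mul]

theorem isCapitalPath_capital {c : ℝ → ℝ} (hc : LocallyIntegrableOn c (Ici 0)) :
    E.IsCapitalPath c (E.capital c) := by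
  have hcd : LocallyIntegrableOn (fun u => -(Real.exp (-(E.netReturn * u)) * c u)) (Ici 0) :=
    (hc.continuousOn_mul (by fun_prop) isClosed_Ici.isLocallyClosed).neg
  have hcap : ∀ t, E.capital c t = Real.exp (E.netReturn * t) *
      (E.k₀ + ∫ u in (0 : ℝ)..t, -(Real.exp (-(E.netReturn * u)) * c u)) := by
    intro t
    rw [capital, intervalIntegral.integral_neg, sub_eq_add_neg]
  constructor
  · intro t ht
    -- The interval is extended past `t` so that it is a neighbourhood of `t` within `[0, ∞)`.
    have ht' : (0 : ℝ) ≤ t + 1 := by linarith [mem_Ici.1 ht]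
    have h1 := ((absolutelyContinuousOnInterval_exp_mul E.netReturn 0 (t + 1)).mul
      (absolutelyContinuousOnInterval_const_add_integral E.k₀
        (hcd.intervalIntegrable_zero ht'))).continuousOn
    rw [uIcc_of_le ht'] at h1
    have h2 := h1 t ⟨ht, by linarith⟩
    have h3 : ContinuousWithinAt (E.capital c) (Icc 0 (t + 1)) t := by
      rw [funext hcap]
      exact h2
    refine h3.mono_of_mem_nhdsWithin ?_
    rw [← Ici_inter_Iic]
    exact inter_mem self_mem_nhdsWithin (mem_nhdsWithin_of_mem_nhds (Iic_mem_nhds (by linarith)))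
  · intro t ht
    have h := integral_exp_mul_primitive E.netReturn E.k₀ (hcd.intervalIntegrable_zero ht)
    rw [← hcap] at h
    have h2 : ∫ s in (0 : ℝ)..t, (E.netReturn * E.capital c s - c s) = E.capital c t - E.k₀ := by
      rw [← h]
      refine intervalIntegral.integral_congr fun s _ => ?_
      rw [← hcap, mul_neg, ← mul_assoc (Real.exp _), ← Real.exp_add, add_neg_cancel,
        Real.exp_zero, one_mul, sub_eq_add_neg]
    rw [h2]
    ring

/-- A nonnegative consumption path whose partial present values are bounded has a present value. -/
theorem hasPresentValue_of_integral_le {c : ℝ → ℝ} (hc : LocallyIntegrableOn c (Ici 0))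
    (hc0 : ∀ᵐ t ∂volume.restrict (Ici (0 : ℝ)), 0 ≤ c t) {b : ℝ}
    (hb : ∀ t, 0 ≤ t → ∫ u in (0 : ℝ)..t, Real.exp (-(E.netReturn * u)) * c u ≤ b) :
    E.HasPresentValue c ∧ E.presentValue c ≤ b := by
  have hcd : LocallyIntegrableOn (fun u => Real.exp (-(E.netReturn * u)) * c u) (Ici 0) :=
    hc.continuousOn_mul (by fun_prop) isClosed_Ici.isLocallyClosed
  have hint : IntegrableOn (fun u => Real.exp (-(E.netReturn * u)) * c u) (Ioi 0) := by
    refine integrableOn_Ioi_of_intervalIntegral_norm_bounded (l := atTop) (b := id) b 0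
      (fun T => (locallyIntegrableOn_Ici_iff.1 hcd T).mono_set Ioc_subset_Icc_self) tendsto_id ?_
    filter_upwards [eventually_ge_atTop 0] with T hT
    refine le_trans (le_of_eq ?_) (hb T hT)
    rw [id, intervalIntegral.integral_of_le hT, intervalIntegral.integral_of_le hT]
    refine integral_congr_ae ?_
    have h1 := ae_restrict_of_ae_restrict_of_subset (Ioc_subset_Icc_self.trans Icc_subset_Ici_self :
      Ioc (0 : ℝ) T ⊆ Ici 0) hc0
    filter_upwards [h1] with u hu
    exact Real.norm_of_nonneg (mul_nonneg (Real.exp_pos _).le hu)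
  refine ⟨by rwa [HasPresentValue, integrableOn_Ici_iff_integrableOn_Ioi], ?_⟩
  rw [presentValue, integral_Ici_eq_integral_Ioi]
  refine le_of_tendsto (intervalIntegral_tendsto_integral_Ioi 0 hint tendsto_id) ?_
  filter_upwards [eventually_ge_atTop 0] with T hT
  exact hb T hT

theorem HasPresentValue.integral_le {c : ℝ → ℝ} (hc : E.HasPresentValue c)
    (hc0 : ∀ᵐ t ∂volume.restrict (Ici (0 : ℝ)), 0 ≤ c t) {t : ℝ} (ht : 0 ≤ t) :
    ∫ u in (0 : ℝ)..t, Real.exp (-(E.netReturn * u)) * c u ≤ E.presentValue c := by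
  rw [intervalIntegral.integral_of_le ht]
  refine setIntegral_mono_set hc ?_
    (Ioc_subset_Icc_self.trans Icc_subset_Ici_self).eventuallyLE
  filter_upwards [hc0] with u hu
  exact mul_nonneg (Real.exp_pos _).le hu

/-- The intertemporal budget constraint. -/
theorem IsCapitalPath.budget {c k : ℝ → ℝ} (hc : LocallyIntegrableOn c (Ici 0))
    (hc0 : ∀ᵐ t ∂volume.restrict (Ici (0 : ℝ)), 0 ≤ c t) (hk : E.IsCapitalPath c k)
    (hk0 : ∀ t, 0 ≤ t → 0 ≤ k t) : E.HasPresentValue c ∧ E.presentValue c ≤ E.k₀ := by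
  refine hasPresentValue_of_integral_le hc hc0 fun t ht => ?_
  have h1 := hk.eq hc ht
  have h2 := mul_nonneg (Real.exp_pos (-(E.netReturn * t))).le (hk0 t ht)
  linarith

/-- Converse of the budget constraint: for nonnegative `c`, partial present values stay below the
total one, so capital never turns negative. -/
theorem capital_nonneg {c : ℝ → ℝ} (hc : E.HasPresentValue c)
    (hc0 : ∀ᵐ t ∂volume.restrict (Ici (0 : ℝ)), 0 ≤ c t) (hb : E.presentValue c ≤ E.k₀)
    {t : ℝ} (ht : 0 ≤ t) : 0 ≤ E.capital c t :=
  mul_nonneg (Real.exp_pos _).le (sub_nonneg.2 ((hc.integral_le hc0 ht).trans hb))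

end HabitEconomy

/-! ### Renewal equations with a kernel of mass less than one. -/

/-- Convolution of a real function `F` with a kernel `κ`. -/
noncomputable def kernelConv (κ F : ℝ → ℝ) (t : ℝ) : ℝ := ∫ u, F u * κ (t - u)

section KernelConv

variable {κ F G : ℝ → ℝ}

theorem kernelConv_congr_ae (h : F =ᵐ[volume] G) : kernelConv κ F = kernelConv κ G := by
  funext t
  refine integral_congr_ae ?_
  filter_upwards [h] with u hu
  rw [hu]

theorem kernelConv_nonneg (hκ0 : ∀ s, 0 ≤ κ s) (hF : ∀ᵐ u, 0 ≤ F u) (t : ℝ) :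
    0 ≤ kernelConv κ F t := by
  refine integral_nonneg_of_ae ?_
  filter_upwards [hF] with u hu
  exact mul_nonneg hu (hκ0 _)

theorem abs_kernelConv_le (hκ0 : ∀ s, 0 ≤ κ s) (t : ℝ) :
    |kernelConv κ F t| ≤ kernelConv κ (fun u => |F u|) t := by
  refine abs_integral_le_integral_abs.trans (le_of_eq ?_)
  refine integral_congr_ae (Eventually.of_forall fun u => ?_)
  simp only [abs_mul, abs_of_nonneg (hκ0 _)]

theorem integrable_kernelConv (hκ : Integrable κ) (hF : Integrable F) :
    Integrable (kernelConv κ F) :=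
  hF.integrable_convolution (ContinuousLinearMap.mul ℝ ℝ) hκ

theorem integral_kernelConv (hκ : Integrable κ) (hF : Integrable F) :
    ∫ t, kernelConv κ F t = (∫ s, κ s) * ∫ u, F u :=
  (integral_convolution (ContinuousLinearMap.mul ℝ ℝ) hF hκ).trans (mul_comm _ _)

theorem integrable_kernelConv_integrand {M : ℝ} (hκ : Integrable κ) (hM : ∀ s, |κ s| ≤ M)
    (hF : Integrable F) (t : ℝ) : Integrable (fun u => F u * κ (t - u)) :=
  hF.mul_bdd (hκ.comp_sub_left t).aestronglyMeasurable (Eventually.of_forall fun u => hM (t - u))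

theorem kernelConv_add {M : ℝ} (hκ : Integrable κ) (hM : ∀ s, |κ s| ≤ M)
    (hF : Integrable F) (hG : Integrable G) (t : ℝ) :
    kernelConv κ (fun u => F u + G u) t = kernelConv κ F t + kernelConv κ G t := by
  unfold kernelConv
  simp only [add_mul]
  exact integral_add (integrable_kernelConv_integrand hκ hM hF t)
    (integrable_kernelConv_integrand hκ hM hG t)

theorem kernelConv_sub {M : ℝ} (hκ : Integrable κ) (hM : ∀ s, |κ s| ≤ M)
    (hF : Integrable F) (hG : Integrable G) (t : ℝ) :
    kernelConv κ (fun u => F u - G u) t = kernelConv κ F t - kernelConv κ G t := by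
  unfold kernelConv
  simp only [sub_mul]
  exact integral_sub (integrable_kernelConv_integrand hκ hM hF t)
    (integrable_kernelConv_integrand hκ hM hG t)

theorem kernelConv_mono {M : ℝ} (hκ : Integrable κ) (hκ0 : ∀ s, 0 ≤ κ s) (hM : ∀ s, |κ s| ≤ M)
    (hF : Integrable F) (hG : Integrable G) (h : ∀ u, F u ≤ G u) (t : ℝ) :
    kernelConv κ F t ≤ kernelConv κ G t :=
  integral_mono (integrable_kernelConv_integrand hκ hM hF t)
    (integrable_kernelConv_integrand hκ hM hG t)
    fun u => mul_le_mul_of_nonneg_right (h u) (hκ0 _)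

/-- A function dominated by its convolution with a kernel of mass less than one vanishes. -/
theorem ae_eq_zero_of_abs_le_kernelConv (hκ : Integrable κ) (hκ1 : ∫ s, κ s < 1)
    (hF : Integrable F) (h : ∀ᵐ t, |F t| ≤ kernelConv κ (fun u => |F u|) t) :
    F =ᵐ[volume] 0 := by
  -- Integrating the domination gives `‖F‖₁ ≤ m ‖F‖₁` with `m < 1` the mass of the kernel.
  have h1 := integral_mono_ae hF.abs (integrable_kernelConv hκ hF.abs) h
  rw [integral_kernelConv hκ hF.abs] at h1
  have h0 : 0 ≤ ∫ t, |F t| := integral_nonneg fun _ => abs_nonneg _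
  have h2 : ∫ t, |F t| = 0 := by nlinarith
  have h3 := (integral_eq_zero_iff_of_nonneg (fun _ => abs_nonneg _) hF.abs).1 h2
  filter_upwards [h3] with t ht
  exact abs_eq_zero.1 ht

/-- The renewal equation `F = 1_S · (κ * F) + b` has an integrable solution if the kernel has
mass less than one. -/
theorem exists_renewal {M : ℝ} (hκ : Integrable κ) (hκ0 : ∀ s, 0 ≤ κ s) (hM : ∀ s, |κ s| ≤ M)
    (hκ1 : ∫ s, κ s < 1) {S : Set ℝ} (hS : MeasurableSet S) {b : ℝ → ℝ} (hb : Integrable b) :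
    ∃ F : ℝ → ℝ, Integrable F ∧ F =ᵐ[volume] fun t => S.indicator (kernelConv κ F) t + b t := by
  have hint : ∀ f : ℝ →₁[volume] ℝ,
      Integrable (fun t => S.indicator (kernelConv κ f) t + b t) := fun f =>
    ((integrable_kernelConv hκ (L1.integrable_coeFn f)).indicator hS).add hb
  set T : (ℝ →₁[volume] ℝ) → (ℝ →₁[volume] ℝ) := fun f => (hint f).toL1 _ with hT
  have hD0 : 0 ≤ ∫ s, κ s := integral_nonneg hκ0
  -- The inhomogeneous term cancels in differences, and convolution shrinks the `L¹` norm by the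
  -- mass of the kernel.
  have hcontr : ContractingWith (⟨∫ s, κ s, hD0⟩ : NNReal) T := by
    refine ⟨by exact_mod_cast hκ1, LipschitzWith.of_dist_le_mul fun f g => ?_⟩
    have hfg := L1.integrable_coeFn (f - g)
    rw [dist_eq_norm, dist_eq_norm, L1.norm_eq_integral_norm, L1.norm_eq_integral_norm]
    change _ ≤ (∫ s, κ s) * ∫ a, |(f - g : ℝ →₁[volume] ℝ) a|
    rw [← integral_kernelConv hκ hfg.abs]
    refine integral_mono_ae (L1.integrable_coeFn _).norm (integrable_kernelConv hκ hfg.abs) ?_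
    filter_upwards [Lp.coeFn_sub (T f) (T g), (hint f).coeFn_toL1, (hint g).coeFn_toL1]
      with t h1 h2 h3
    have h4 : kernelConv κ f t - kernelConv κ g t = kernelConv κ (f - g : ℝ →₁[volume] ℝ) t := by
      rw [← kernelConv_sub hκ hM (L1.integrable_coeFn f) (L1.integrable_coeFn g),
        kernelConv_congr_ae (Lp.coeFn_sub f g)]
      rfl
    rw [h1, Pi.sub_apply, h2, h3, add_sub_add_right_eq_sub]
    refine le_trans ?_ (abs_kernelConv_le hκ0 t)
    by_cases ht : t ∈ S
    · rw [indicator_of_mem ht, indicator_of_mem ht, h4, Real.norm_eq_abs]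
    · rw [indicator_of_notMem ht, indicator_of_notMem ht, sub_zero, norm_zero]
      exact abs_nonneg _
  set f := ContractingWith.fixedPoint T hcontr
  have hf : T f = f := hcontr.fixedPoint_isFixedPt
  refine ⟨f, L1.integrable_coeFn f, ?_⟩
  have h := (hint f).coeFn_toL1
  change (T f : ℝ → ℝ) =ᵐ[volume] _ at h
  rwa [hf] at h

/-- Solutions of the renewal equation with nonnegative data are nonnegative. -/
theorem renewal_nonneg {M : ℝ} (hκ : Integrable κ) (hκ0 : ∀ s, 0 ≤ κ s) (hM : ∀ s, |κ s| ≤ M)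
    (hκ1 : ∫ s, κ s < 1) {S : Set ℝ} {b : ℝ → ℝ} (hb : ∀ᵐ t, 0 ≤ b t) (hF : Integrable F)
    (h : F =ᵐ[volume] fun t => S.indicator (kernelConv κ F) t + b t) : ∀ᵐ t, 0 ≤ F t := by
  -- The negative part satisfies `N ≤ κ * N`: from `F + N ≥ 0` follows `-(κ * F) ≤ κ * N`, and `b ≥
  -- 0` only helps. So `N` vanishes.
  set N : ℝ → ℝ := fun t => max (-F t) 0 with hN
  have hNint : Integrable N := hF.neg.pos_part
  have hN0 : ∀ t, 0 ≤ N t := fun t => le_max_right _ _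
  have hconv : ∀ t, -kernelConv κ F t ≤ kernelConv κ N t := fun t => by
    have h1 := kernelConv_mono hκ hκ0 hM (F := fun _ => 0) (G := fun u => F u + N u)
      (integrable_zero _ _ _) (hF.add hNint)
      (fun u => by linarith [le_max_left (-F u) 0]) t
    rw [kernelConv_add hκ hM hF hNint] at h1
    have h2 : kernelConv κ (fun _ => 0) t = 0 := by simp [kernelConv]
    linarith
  have hNz := ae_eq_zero_of_abs_le_kernelConv hκ hκ1 hNint (by
    filter_upwards [h, hb] with t ht hbt
    simp only [abs_of_nonneg (hN0 _)]
    have hpos := kernelConv_nonneg hκ0 (Eventually.of_forall hN0) t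
    refine max_le ?_ hpos
    by_cases htS : t ∈ S
    · rw [indicator_of_mem htS] at ht
      linarith [hconv t]
    · rw [indicator_of_notMem htS] at ht
      linarith)
  filter_upwards [hNz] with t ht
  have := le_max_left (-F t) 0
  change max (-F t) 0 = 0 at ht
  linarith

end KernelConv

/-! ### Habits as a convolution, their present value, and recovery of consumption from its excess.
-/

namespace HabitEconomy

variable (E : HabitEconomy)

/-- The habit kernel, discounted at the net return. -/
noncomputable def habitKernel : ℝ → ℝ :=
  (Ico 0 E.τ).indicator fun s => E.ε * Real.exp (-((E.netReturn + E.η) * s))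

/-- The discounted consumption history. -/
noncomputable def discountedHistory : ℝ → ℝ :=
  (Ico (-E.τ) 0).indicator fun u => Real.exp (-(E.netReturn * u)) * E.c₀ u

/-- A consumption path on `[0, ∞)`, discounted and extended by zero. -/
noncomputable def discountedPath (c : ℝ → ℝ) : ℝ → ℝ :=
  (Ici 0).indicator fun u => Real.exp (-(E.netReturn * u)) * c u

/-- The share of the present value of consumption which is absorbed by habits. -/
noncomputable def habitShare : ℝ :=
  E.ε * ∫ s in (-E.τ)..0, Real.exp ((E.A - E.δ + E.η) * s)

/-- The present value of the habits inherited from the history. -/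
noncomputable def historyValue : ℝ :=
  ∫ s in (-E.τ)..0, Real.exp ((E.A - E.δ) * s) *
      (E.ε * ∫ u in (-E.τ)..s, E.c₀ (u - s) * Real.exp (E.η * u))

theorem initialG_eq : E.initialG = (1 - E.habitShare) * E.k₀ - E.historyValue := rfl

variable {E}

/-- The characteristic function `f` equals `D` at `r` and drops below `1` for large arguments. If `D
≥ 1`, the intermediate value theorem would give a root at or above `r`. -/
theorem habitShare_lt_one (hε : 0 ≤ E.ε)
    (hroot : ∀ lam : ℝ, E.IsCharacteristicRoot lam → lam < E.A - E.δ) : E.habitShare < 1 := by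
  by_contra! hD
  set f : ℝ → ℝ := fun lam => E.ε * ∫ u in (-E.τ)..0, Real.exp ((lam + E.η) * u) with hf
  have hcont : Continuous f := by
    refine continuous_const.mul
      (intervalIntegral.continuous_parametric_intervalIntegral_of_continuous' ?_ _ _)
    fun_prop
  set L : ℝ := max (E.A - E.δ) (E.ε + 1 - E.η) with hL
  have hLpos : E.ε + 1 ≤ L + E.η := by linarith [le_max_right (E.A - E.δ) (E.ε + 1 - E.η)]
  have hfL : f L < 1 := by
    have h1 := intervalIntegral.mul_integral_comp_mul_left (a := -E.τ) (b := 0) (c := L + E.η)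
      (f := Real.exp)
    rw [integral_exp, mul_zero, Real.exp_zero] at h1
    have h2 := Real.exp_pos ((L + E.η) * -E.τ)
    have h3 : (L + E.η) * f L ≤ E.ε := by
      have : (L + E.η) * f L = E.ε * ((L + E.η) * ∫ u in (-E.τ)..0, Real.exp ((L + E.η) * u)) := by
        rw [hf]
        ring
      rw [this, h1]
      nlinarith
    by_contra! h4
    nlinarith
  obtain ⟨lam, hlam, hlam1⟩ := intermediate_value_Icc' (le_max_left (E.A - E.δ) (E.ε + 1 - E.η))
    hcont.continuousOn (show (1 : ℝ) ∈ Icc (f L) (f (E.A - E.δ)) from ⟨hfL.le, hD⟩)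
  exact (hroot lam hlam1.symm).not_ge hlam.1

theorem habitKernel_nonneg (hε : 0 ≤ E.ε) (s : ℝ) : 0 ≤ E.habitKernel s :=
  indicator_nonneg (fun _ _ => mul_nonneg hε (Real.exp_pos _).le) s

theorem abs_habitKernel_le (hε : 0 ≤ E.ε) (s : ℝ) :
    |E.habitKernel s| ≤ E.ε * Real.exp (|E.netReturn + E.η| * |E.τ|) := by
  rw [abs_of_nonneg (habitKernel_nonneg hε s), habitKernel]
  refine indicator_le' (fun s hs => ?_) (fun _ _ => mul_nonneg hε (Real.exp_pos _).le) s
  refine mul_le_mul_of_nonneg_left (Real.exp_le_exp.2 ?_) hε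
  calc -((E.netReturn + E.η) * s) ≤ |(E.netReturn + E.η) * s| := neg_le_abs _
    _ = |E.netReturn + E.η| * |s| := abs_mul _ _
    _ ≤ _ := mul_le_mul_of_nonneg_left
      (abs_le_abs_of_nonneg hs.1 hs.2.le) (abs_nonneg _)

theorem integrable_habitKernel : Integrable E.habitKernel := by
  refine IntegrableOn.integrable_indicator ?_ measurableSet_Ico
  exact (Continuous.integrableOn_Icc (by fun_prop)).mono_set Ico_subset_Icc_self

theorem integral_habitKernel (hτ : 0 ≤ E.τ) : ∫ s, E.habitKernel s = E.habitShare := by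
  rw [habitKernel, integral_indicator measurableSet_Ico, integral_Ico_eq_integral_Ioc,
    ← intervalIntegral.integral_of_le hτ, intervalIntegral.integral_const_mul, habitShare]
  have h := intervalIntegral.integral_comp_neg (a := 0) (b := E.τ)
    (fun s => Real.exp ((E.netReturn + E.η) * s))
  rw [neg_zero] at h
  rw [← h]
  simp only [mul_neg]

theorem integrable_discountedHistory (hc₀ : IntegrableOn E.c₀ (Ico (-E.τ) 0)) :
    Integrable E.discountedHistory := by
  refine IntegrableOn.integrable_indicator ?_ measurableSet_Ico
  have h : IntegrableOn E.c₀ (Icc (-E.τ) 0) := by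
    rwa [integrableOn_Icc_iff_integrableOn_Ico]
  exact (h.continuousOn_mul (by fun_prop) isCompact_Icc).mono_set Ico_subset_Icc_self

theorem discountedHistory_nonneg
    (hc₀_nonneg : ∀ᵐ s ∂volume.restrict (Ico (-E.τ) 0), 0 ≤ E.c₀ s) :
    ∀ᵐ u, 0 ≤ E.discountedHistory u := by
  rw [ae_restrict_iff' measurableSet_Ico] at hc₀_nonneg
  filter_upwards [hc₀_nonneg] with u hu
  exact indicator_apply_nonneg fun h => mul_nonneg (Real.exp_pos _).le (hu h)

theorem integrable_discountedPath {c : ℝ → ℝ} (hc : E.HasPresentValue c) :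
    Integrable (E.discountedPath c) :=
  IntegrableOn.integrable_indicator hc measurableSet_Ici

theorem integral_discountedPath (c : ℝ → ℝ) : ∫ u, E.discountedPath c u = E.presentValue c :=
  integral_indicator measurableSet_Ici

theorem discountedPath_nonneg {c : ℝ → ℝ}
    (hc : ∀ᵐ t ∂volume.restrict (Ici (0 : ℝ)), 0 ≤ c t) : ∀ᵐ u, 0 ≤ E.discountedPath c u := by
  rw [ae_restrict_iff' measurableSet_Ici] at hc
  filter_upwards [hc] with u hu
  exact indicator_apply_nonneg fun h => mul_nonneg (Real.exp_pos _).le (hu h)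

theorem discountedPath_congr {c c' : ℝ → ℝ}
    (h : c =ᵐ[volume.restrict (Ici (0 : ℝ))] c') :
    E.discountedPath c =ᵐ[volume] E.discountedPath c' := by
  rw [Filter.EventuallyEq, ae_restrict_iff' measurableSet_Ici] at h
  filter_upwards [h] with u hu
  by_cases h0 : u ∈ Ici (0 : ℝ)
  · rw [discountedPath, discountedPath, indicator_of_mem h0, indicator_of_mem h0, hu h0]
  · rw [discountedPath, discountedPath, indicator_of_notMem h0, indicator_of_notMem h0]

/-- The discounted habit as a convolution. -/
theorem exp_mul_habit (hτ : 0 ≤ E.τ) (c : ℝ → ℝ) {t : ℝ} (ht : 0 ≤ t) :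
    Real.exp (-(E.netReturn * t)) * E.habit c t =
      kernelConv E.habitKernel (fun u => E.discountedHistory u + E.discountedPath c u) t := by
  rw [habit, intervalIntegral.integral_of_le (by linarith), ← integral_const_mul,
    ← integral_const_mul, ← integral_indicator measurableSet_Ioc, kernelConv]
  refine integral_congr_ae (Eventually.of_forall fun u => ?_)
  by_cases hu : u ∈ Ioc (t - E.τ) t
  · have h1 : t - u ∈ Ico 0 E.τ := ⟨by linarith [hu.2], by linarith [hu.1]⟩
    have h2 : E.discountedHistory u + E.discountedPath c u =
        Real.exp (-(E.netReturn * u)) * E.concat c u := by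
      by_cases h0 : u < 0
      · have h3 : u ∈ Ico (-E.τ) 0 := ⟨by linarith [hu.1], h0⟩
        have h4 : u ∉ Ici (0 : ℝ) := by simpa using h0
        rw [discountedHistory, discountedPath, indicator_of_mem h3, indicator_of_notMem h4, concat,
          if_pos h0, add_zero]
      · have h3 : u ∉ Ico (-E.τ) 0 := fun h => h0 h.2
        have h4 : u ∈ Ici (0 : ℝ) := not_lt.1 h0
        rw [discountedHistory, discountedPath, indicator_of_notMem h3, indicator_of_mem h4, concat,
          if_neg h0, zero_add]
    have h5 : Real.exp (-(E.netReturn * t)) * Real.exp (E.η * (u - t)) =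
        Real.exp (-(E.netReturn * u)) * Real.exp (-((E.netReturn + E.η) * (t - u))) := by
      rw [← Real.exp_add, ← Real.exp_add]
      ring_nf
    simp only [indicator_of_mem hu, h2, habitKernel, indicator_of_mem h1]
    linear_combination E.ε * E.concat c u * h5
  · have h1 : t - u ∉ Ico 0 E.τ := fun h => hu ⟨by linarith [h.2], by linarith [h.1]⟩
    simp only [indicator_of_notMem hu, habitKernel, indicator_of_notMem h1, mul_zero]

theorem habit_congr (hτ : 0 ≤ E.τ) {c c' : ℝ → ℝ}
    (h : c =ᵐ[volume.restrict (Ici (0 : ℝ))] c') {t : ℝ} (ht : 0 ≤ t) :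
    E.habit c t = E.habit c' t := by
  refine mul_left_cancel₀ (Real.exp_pos (-(E.netReturn * t))).ne' ?_
  rw [exp_mul_habit hτ c ht, exp_mul_habit hτ c' ht]
  refine congrFun (kernelConv_congr_ae ?_) t
  filter_upwards [discountedPath_congr (E := E) h] with u hu
  rw [hu]

theorem habit_nonneg (hε : 0 ≤ E.ε) (hτ : 0 ≤ E.τ)
    (hc₀_nonneg : ∀ᵐ s ∂volume.restrict (Ico (-E.τ) 0), 0 ≤ E.c₀ s) {c : ℝ → ℝ}
    (hc : ∀ᵐ t ∂volume.restrict (Ici (0 : ℝ)), 0 ≤ c t) {t : ℝ} (ht : 0 ≤ t) :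
    0 ≤ E.habit c t := by
  refine nonneg_of_mul_nonneg_right ?_ (Real.exp_pos (-(E.netReturn * t)))
  rw [exp_mul_habit hτ c ht]
  refine kernelConv_nonneg (habitKernel_nonneg hε) ?_ t
  filter_upwards [discountedHistory_nonneg hc₀_nonneg, discountedPath_nonneg hc] with u h1 h2
  exact add_nonneg h1 h2

theorem exp_mul_habit_eq_add (hε : 0 ≤ E.ε) (hτ : 0 ≤ E.τ)
    (hc₀ : IntegrableOn E.c₀ (Ico (-E.τ) 0)) {c : ℝ → ℝ}
    (hc : E.HasPresentValue c) {t : ℝ} (ht : 0 ≤ t) :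
    Real.exp (-(E.netReturn * t)) * E.habit c t =
      kernelConv E.habitKernel E.discountedHistory t +
        kernelConv E.habitKernel (E.discountedPath c) t := by
  rw [exp_mul_habit hτ c ht, kernelConv_add integrable_habitKernel (abs_habitKernel_le hε)
    (integrable_discountedHistory hc₀) (integrable_discountedPath hc)]

theorem kernelConv_discountedPath_of_neg (c : ℝ → ℝ) {t : ℝ} (ht : t < 0) :
    kernelConv E.habitKernel (E.discountedPath c) t = 0 := by
  rw [kernelConv]
  refine integral_eq_zero_of_ae (Eventually.of_forall fun u => ?_)
  by_cases hu : u ∈ Ici (0 : ℝ)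
  · have h1 : t - u ∉ Ico 0 E.τ := fun h => by linarith [h.1, mem_Ici.1 hu]
    simp [habitKernel, indicator_of_notMem h1]
  · simp [discountedPath, indicator_of_notMem hu]

theorem integral_Ici_kernelConv_discountedPath (hτ : 0 ≤ E.τ) {c : ℝ → ℝ}
    (hc : E.HasPresentValue c) :
    ∫ t in Ici (0 : ℝ), kernelConv E.habitKernel (E.discountedPath c) t =
      E.habitShare * E.presentValue c := by
  rw [setIntegral_eq_integral_of_forall_compl_eq_zero
    (fun t ht => kernelConv_discountedPath_of_neg c (by simpa using ht)),
    integral_kernelConv integrable_habitKernel (integrable_discountedPath hc),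
    integral_habitKernel hτ, integral_discountedPath]

/-- Memory lasts `τ`, so the history before `0` is forgotten after time `τ`. -/
theorem kernelConv_discountedHistory_of_gt {t : ℝ} (ht : E.τ < t) :
    kernelConv E.habitKernel E.discountedHistory t = 0 := by
  rw [kernelConv]
  refine integral_eq_zero_of_ae (Eventually.of_forall fun u => ?_)
  by_cases hu : u ∈ Ico (-E.τ) 0
  · have h1 : t - u ∉ Ico 0 E.τ := fun h => by linarith [h.2, hu.2]
    simp [habitKernel, indicator_of_notMem h1]
  · simp [discountedHistory, indicator_of_notMem hu]

/-- Substituting `s = -t` identifies the habit inherited from the history with the integrand of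
`historyValue`. -/
theorem kernelConv_discountedHistory {t : ℝ} (ht : t ∈ Ioc 0 E.τ) :
    kernelConv E.habitKernel E.discountedHistory t = Real.exp ((E.A - E.δ) * -t) *
      (E.ε * ∫ u in (-E.τ)..(-t), E.c₀ (u - -t) * Real.exp (E.η * u)) := by
  have h1 := intervalIntegral.integral_comp_add_right (a := -E.τ) (b := -t)
    (fun v => E.c₀ v * Real.exp (E.η * (v - t))) t
  simp only [add_sub_cancel_right, neg_add_cancel] at h1
  simp only [sub_neg_eq_add]
  rw [h1, intervalIntegral.integral_of_le (by linarith [ht.2]), ← integral_Ico_eq_integral_Ioc,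
    integral_Ico_eq_integral_Ioo, ← integral_const_mul, ← integral_const_mul,
    ← integral_indicator measurableSet_Ioo, kernelConv]
  refine integral_congr_ae (Eventually.of_forall fun u => ?_)
  -- Both endpoints drop out: at `u = t - τ` the kernel vanishes, and `0` is not part of the
  -- history.
  by_cases hu : u ∈ Ioo (-E.τ + t) 0
  · have h2 : t - u ∈ Ico 0 E.τ := ⟨by linarith [hu.2, ht.1], by linarith [hu.1]⟩
    have h3 : u ∈ Ico (-E.τ) 0 := ⟨by linarith [hu.1, ht.1], hu.2⟩
    have h5 : Real.exp ((E.A - E.δ) * -t) * Real.exp (E.η * (u - t)) =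
        Real.exp (-(E.netReturn * u)) * Real.exp (-((E.netReturn + E.η) * (t - u))) := by
      rw [← Real.exp_add, ← Real.exp_add]
      ring_nf
    simp only [indicator_of_mem hu, habitKernel, indicator_of_mem h2, discountedHistory,
      indicator_of_mem h3]
    linear_combination (-E.ε * E.c₀ u) * h5
  · rw [indicator_of_notMem hu]
    by_cases h3 : u ∈ Ico (-E.τ) 0
    · have h2 : t - u ∉ Ico 0 E.τ := fun h => hu ⟨by linarith [h.2], h3.2⟩
      simp only [habitKernel, indicator_of_notMem h2, mul_zero]
    · simp only [discountedHistory, indicator_of_notMem h3, zero_mul]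

theorem integral_Ici_kernelConv_discountedHistory (hτ : 0 ≤ E.τ) :
    ∫ t in Ici (0 : ℝ), kernelConv E.habitKernel E.discountedHistory t = E.historyValue := by
  have h := intervalIntegral.integral_comp_neg (a := 0) (b := E.τ)
    (fun s => Real.exp ((E.A - E.δ) * s) *
      (E.ε * ∫ u in (-E.τ)..s, E.c₀ (u - s) * Real.exp (E.η * u)))
  rw [neg_zero, intervalIntegral.integral_of_le hτ] at h
  rw [historyValue, ← h, integral_Ici_eq_integral_Ioi,
    setIntegral_eq_of_subset_of_forall_sdiff_eq_zero measurableSet_Ioi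
      (Ioc_subset_Ioi_self : Ioc (0 : ℝ) E.τ ⊆ Ioi 0)
      (fun t ht => kernelConv_discountedHistory_of_gt (E := E) (t := t) (by
        by_contra hle
        exact ht.2 ⟨ht.1, not_lt.1 hle⟩))]
  exact setIntegral_congr_fun measurableSet_Ioc fun t ht => kernelConv_discountedHistory ht

theorem hasPresentValue_habit (hε : 0 ≤ E.ε) (hτ : 0 ≤ E.τ)
    (hc₀ : IntegrableOn E.c₀ (Ico (-E.τ) 0)) {c : ℝ → ℝ} (hc : E.HasPresentValue c) :
    E.HasPresentValue (E.habit c) := by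
  have h := ((integrable_kernelConv (integrable_habitKernel (E := E))
    (integrable_discountedHistory hc₀)).add (integrable_kernelConv (integrable_habitKernel (E := E))
      (integrable_discountedPath hc))).integrableOn (s := Ici (0 : ℝ))
  refine h.congr_fun (fun t ht => ?_) measurableSet_Ici
  exact (exp_mul_habit_eq_add hε hτ hc₀ hc ht).symm

/-- Fubini: the integral of a convolution is the product of the integrals, so own consumption
contributes the mass of the kernel times its present value. -/
theorem presentValue_habit (hε : 0 ≤ E.ε) (hτ : 0 ≤ E.τ)
    (hc₀ : IntegrableOn E.c₀ (Ico (-E.τ) 0)) {c : ℝ → ℝ} (hc : E.HasPresentValue c) :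
    E.presentValue (E.habit c) = E.habitShare * E.presentValue c + E.historyValue := by
  rw [presentValue, setIntegral_congr_fun measurableSet_Ici
    (fun t ht => exp_mul_habit_eq_add hε hτ hc₀ hc ht), integral_add,
    integral_Ici_kernelConv_discountedHistory hτ, integral_Ici_kernelConv_discountedPath hτ hc,
    add_comm]
  · exact (integrable_kernelConv integrable_habitKernel
      (integrable_discountedHistory hc₀)).integrableOn
  · exact (integrable_kernelConv integrable_habitKernel (integrable_discountedPath hc)).integrableOn

/-- Excess consumption over own habits determines consumption. -/
theorem consumption_unique (hε : 0 ≤ E.ε) (hτ : 0 ≤ E.τ)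
    (hc₀ : IntegrableOn E.c₀ (Ico (-E.τ) 0)) (hD : E.habitShare < 1) {c c' x : ℝ → ℝ}
    (hc : E.HasPresentValue c) (hc' : E.HasPresentValue c')
    (h : (fun t => c t - E.habit c t) =ᵐ[volume.restrict (Ici (0 : ℝ))] x)
    (h' : (fun t => c' t - E.habit c' t) =ᵐ[volume.restrict (Ici (0 : ℝ))] x) :
    c =ᵐ[volume.restrict (Ici (0 : ℝ))] c' := by
  have hI := integrable_discountedPath hc
  have hI' := integrable_discountedPath hc'
  -- The history and the common excess cancel, so the difference of the discounted paths is its own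
  -- convolution on `[0, ∞)`.
  have hzero := ae_eq_zero_of_abs_le_kernelConv
    (F := fun u => E.discountedPath c u - E.discountedPath c' u)
    (integrable_habitKernel (E := E)) (by rwa [integral_habitKernel hτ]) (hI.sub hI') (by
      rw [Filter.EventuallyEq, ae_restrict_iff' measurableSet_Ici] at h h'
      filter_upwards [h, h'] with t ht ht'
      by_cases h0 : t ∈ Ici (0 : ℝ)
      · refine le_trans (le_of_eq ?_) (abs_kernelConv_le (habitKernel_nonneg hε) t)
        rw [kernelConv_sub integrable_habitKernel (abs_habitKernel_le hε) hI hI']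
        have h1 := exp_mul_habit_eq_add hε hτ hc₀ hc h0
        have h2 := exp_mul_habit_eq_add hε hτ hc₀ hc' h0
        have h3 := ht h0
        have h4 := ht' h0
        simp only [discountedPath, indicator_of_mem h0] at h1 h2 ⊢
        congr 1
        linear_combination h1 - h2 + Real.exp (-(E.netReturn * t)) * (h3 - h4)
      · simp only [discountedPath, indicator_of_notMem h0, sub_zero, abs_zero]
        exact kernelConv_nonneg (habitKernel_nonneg hε)
          (Eventually.of_forall fun _ => abs_nonneg _) t)
  rw [Filter.EventuallyEq, ae_restrict_iff' measurableSet_Ici]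
  filter_upwards [hzero] with t ht h0
  simp only [discountedPath, indicator_of_mem h0, Pi.zero_apply] at ht
  rw [← mul_sub] at ht
  exact sub_eq_zero.1 ((mul_eq_zero.1 ht).resolve_left (Real.exp_pos _).ne')

/-- Every nonnegative path of excess consumption is generated by a consumption path. -/
theorem exists_consumption (hε : 0 ≤ E.ε) (hτ : 0 ≤ E.τ)
    (hc₀ : IntegrableOn E.c₀ (Ico (-E.τ) 0))
    (hc₀_nonneg : ∀ᵐ s ∂volume.restrict (Ico (-E.τ) 0), 0 ≤ E.c₀ s) (hD : E.habitShare < 1)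
    {x : ℝ → ℝ} (hx : E.HasPresentValue x) (hx0 : ∀ t, 0 ≤ x t) :
    ∃ c : ℝ → ℝ, E.HasPresentValue c ∧
      (∀ᵐ t ∂volume.restrict (Ici (0 : ℝ)), 0 ≤ c t) ∧
      (fun t => c t - E.habit c t) =ᵐ[volume.restrict (Ici (0 : ℝ))] x := by
  -- In discounted form, `c - h[c] = x` is a renewal equation on `[0, ∞)` whose source is the
  -- inherited habit plus `x`.
  set b : ℝ → ℝ := fun t => (Ici (0 : ℝ)).indicator
    (kernelConv E.habitKernel E.discountedHistory) t + E.discountedPath x t with hb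
  have hbint : Integrable b := ((integrable_kernelConv integrable_habitKernel
    (integrable_discountedHistory hc₀)).indicator measurableSet_Ici).add
      (integrable_discountedPath hx)
  have hb0 : ∀ᵐ t, 0 ≤ b t := by
    filter_upwards [discountedPath_nonneg (E := E) (c := x) (Eventually.of_forall hx0)] with t ht
    exact add_nonneg (indicator_nonneg (fun t _ => kernelConv_nonneg (habitKernel_nonneg hε)
      (discountedHistory_nonneg hc₀_nonneg) t) t) ht
  have hκ1 : ∫ s, E.habitKernel s < 1 := by rwa [integral_habitKernel hτ]
  obtain ⟨F, hF, hFeq⟩ := exists_renewal (integrable_habitKernel (E := E)) (habitKernel_nonneg hε)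
    (abs_habitKernel_le hε) hκ1 measurableSet_Ici hbint
  have hF0 := renewal_nonneg integrable_habitKernel (habitKernel_nonneg hε)
    (abs_habitKernel_le hε) hκ1 hb0 hF hFeq
  set c : ℝ → ℝ := fun t => Real.exp (E.netReturn * t) * F t with hcdef
  have hcF : ∀ t, Real.exp (-(E.netReturn * t)) * c t = F t := fun t => by
    rw [hcdef, ← mul_assoc, ← Real.exp_add, neg_add_cancel, Real.exp_zero, one_mul]
  have hc : E.HasPresentValue c := by
    unfold HasPresentValue
    simp only [hcF]
    exact hF.integrableOn
  -- Before time `0` both the indicator and `b` vanish, so `F` has no mass there and extension by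
  -- zero changes nothing.
  have hpath : E.discountedPath c =ᵐ[volume] F := by
    filter_upwards [hFeq] with t ht
    by_cases h0 : t ∈ Ici (0 : ℝ)
    · rw [discountedPath, indicator_of_mem h0, hcF]
    · rw [discountedPath, indicator_of_notMem h0, ht, indicator_of_notMem h0, hb]
      simp only [indicator_of_notMem h0, discountedPath, add_zero]
  refine ⟨c, hc, ae_restrict_of_ae ?_, ?_⟩
  · filter_upwards [hF0] with t ht
    exact mul_nonneg (Real.exp_pos _).le ht
  · rw [Filter.EventuallyEq, ae_restrict_iff' measurableSet_Ici]
    filter_upwards [hFeq] with t ht h0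
    have h1 := exp_mul_habit_eq_add hε hτ hc₀ hc h0
    rw [kernelConv_congr_ae hpath] at h1
    rw [indicator_of_mem h0, hb] at ht
    simp only [indicator_of_mem h0, discountedPath] at ht
    rw [← hcF t] at ht
    refine mul_left_cancel₀ (Real.exp_pos (-(E.netReturn * t))).ne' ?_
    linear_combination ht - h1

end HabitEconomy

/-! ### Averages over the population. -/

/-- Exchange of the order of two almost everywhere quantifiers. -/
theorem MeasureTheory.AEStronglyMeasurable.ae_ae_swap {α β : Type*} [MeasurableSpace α]
    [MeasurableSpace β] {μ : Measure α} {ν : Measure β} [SFinite μ] [SFinite ν] {g : α × β → ℝ}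
    (hg : AEStronglyMeasurable g (μ.prod ν)) {S : Set ℝ} (hS : MeasurableSet S)
    (h : ∀ᵐ x ∂μ, ∀ᵐ y ∂ν, g (x, y) ∈ S) : ∀ᵐ y ∂ν, ∀ᵐ x ∂μ, g (x, y) ∈ S := by
  -- The quantifiers are exchanged for a measurable representative, then transferred back through
  -- a.e. equality on both orders of the product.
  have hmk := hg.ae_eq_mk
  have h1 : ∀ᵐ x ∂μ, ∀ᵐ y ∂ν, hg.mk g (x, y) ∈ S := by
    filter_upwards [h, Measure.ae_ae_of_ae_prod hmk] with x hx hx'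
    filter_upwards [hx, hx'] with y hy hy'
    rwa [← hy']
  have h2 : ∀ᵐ y ∂ν, ∀ᵐ x ∂μ, hg.mk g (x, y) ∈ S :=
    (Measure.ae_ae_comm (p := fun x y => hg.mk g (x, y) ∈ S)
      (hg.stronglyMeasurable_mk.measurable hS)).1 h1
  have hswap : ∀ᵐ z ∂ν.prod μ, g z.swap = hg.mk g z.swap :=
    Measure.measurePreserving_swap.quasiMeasurePreserving.ae hmk
  filter_upwards [h2, Measure.ae_ae_of_ae_prod hswap] with y hy hy'
  filter_upwards [hy, hy'] with x hx hx'
  have hx'' : g (x, y) = hg.mk g (x, y) := hx'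
  rwa [hx'']

theorem iUnion_Icc_zero_natCast : ⋃ n : ℕ, Icc (0 : ℝ) n = Ici 0 := by
  ext t
  simp only [mem_iUnion, mem_Icc, mem_Ici]
  refine ⟨fun ⟨_, h⟩ => h.1, fun h => ?_⟩
  obtain ⟨n, hn⟩ := exists_nat_ge t
  exact ⟨n, h, hn⟩

namespace HabitEconomy

section Population

variable {E : HabitEconomy} {Ω : Type*} [MeasurableSpace Ω] {μ : Measure Ω} {c : Ω → ℝ → ℝ}

theorem IsIntegrableProfile.integrable_exp_mul (h : IsIntegrableProfile μ c) (T : ℝ) :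
    Integrable (Function.uncurry fun i t => Real.exp (-(E.netReturn * t)) * c i t)
      (μ.prod (volume.restrict (Icc (0 : ℝ) T))) := by
  have hcont : Continuous fun t => Real.exp (-(E.netReturn * t)) := by fun_prop
  obtain ⟨M, hM⟩ := (isCompact_Icc (a := (0 : ℝ)) (b := T)).exists_bound_of_continuousOn
    hcont.continuousOn
  refine (h T).bdd_mul (c := M) (f := fun p : Ω × ℝ => Real.exp (-(E.netReturn * p.2)))
    (hcont.aestronglyMeasurable.comp_snd) ?_
  have : ∀ᵐ t ∂volume.restrict (Icc (0 : ℝ) T), ‖Real.exp (-(E.netReturn * t))‖ ≤ M :=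
    (ae_restrict_iff' measurableSet_Icc).2 (Eventually.of_forall hM)
  exact Measure.quasiMeasurePreserving_snd.ae this

variable [IsProbabilityMeasure μ]

theorem averageConsumption_const (c : ℝ → ℝ) : averageConsumption μ (fun _ => c) = c := by
  funext t
  simp [averageConsumption]

theorem isIntegrableProfile_const {c : ℝ → ℝ} (hc : LocallyIntegrableOn c (Ici 0)) :
    IsIntegrableProfile μ (fun _ => c) := fun T =>
  Integrable.comp_snd (locallyIntegrableOn_Ici_iff.1 hc T) μ

theorem IsIntegrableProfile.aestronglyMeasurable (h : IsIntegrableProfile μ c) :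
    AEStronglyMeasurable (Function.uncurry c) (μ.prod (volume.restrict (Ici (0 : ℝ)))) := by
  have hprod : ∀ s : Set ℝ, μ.prod (volume.restrict s) =
      (μ.prod volume).restrict (univ ×ˢ s) := fun s => by
    rw [← Measure.prod_restrict, Measure.restrict_univ]
  rw [hprod, ← iUnion_Icc_zero_natCast, prod_iUnion, aestronglyMeasurable_iUnion_iff]
  intro n
  rw [← hprod]
  exact (h n).aestronglyMeasurable

theorem IsIntegrableProfile.locallyIntegrableOn_averageConsumption (h : IsIntegrableProfile μ c) :
    LocallyIntegrableOn (averageConsumption μ c) (Ici 0) :=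
  locallyIntegrableOn_Ici_iff.2 fun T => (h T).integral_prod_right

theorem IsIntegrableProfile.ae_integrable (h : IsIntegrableProfile μ c) :
    ∀ᵐ t ∂volume.restrict (Ici (0 : ℝ)), Integrable (fun i => c i t) μ := by
  rw [← iUnion_Icc_zero_natCast, ae_restrict_iUnion_iff]
  exact fun n => (h n).prod_left_ae

theorem IsIntegrableProfile.ae_ae_nonneg (h : IsIntegrableProfile μ c)
    (h0 : ∀ᵐ i ∂μ, ∀ᵐ t ∂volume.restrict (Ici (0 : ℝ)), 0 ≤ c i t) :
    ∀ᵐ t ∂volume.restrict (Ici (0 : ℝ)), ∀ᵐ i ∂μ, 0 ≤ c i t :=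
  h.aestronglyMeasurable.ae_ae_swap measurableSet_Ici h0

theorem IsIntegrableProfile.averageConsumption_nonneg (h : IsIntegrableProfile μ c)
    (h0 : ∀ᵐ i ∂μ, ∀ᵐ t ∂volume.restrict (Ici (0 : ℝ)), 0 ≤ c i t) :
    ∀ᵐ t ∂volume.restrict (Ici (0 : ℝ)), 0 ≤ averageConsumption μ c t := by
  filter_upwards [h.ae_ae_nonneg h0] with t ht
  exact integral_nonneg_of_ae ht

/-- If almost all households consume the same path, then so does the average. -/
theorem IsIntegrableProfile.averageConsumption_ae_eq (h : IsIntegrableProfile μ c) {d : ℝ → ℝ}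
    (hd : AEMeasurable d (volume.restrict (Ici (0 : ℝ))))
    (hcd : ∀ᵐ i ∂μ, c i =ᵐ[volume.restrict (Ici (0 : ℝ))] d) :
    averageConsumption μ c =ᵐ[volume.restrict (Ici (0 : ℝ))] d := by
  have hm : AEStronglyMeasurable (fun p : Ω × ℝ => Function.uncurry c p - d p.2)
      (μ.prod (volume.restrict (Ici (0 : ℝ)))) :=
    h.aestronglyMeasurable.sub hd.aestronglyMeasurable.comp_snd
  have h1 := hm.ae_ae_swap (measurableSet_singleton (0 : ℝ)) (by
    filter_upwards [hcd] with i hi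
    filter_upwards [hi] with t ht
    simp [ht])
  filter_upwards [h1] with t ht
  have h2 : ∀ᵐ i ∂μ, c i t = d t := by
    filter_upwards [ht] with i hi
    exact sub_eq_zero.1 hi
  rw [averageConsumption, integral_congr_ae h2]
  simp

/-- A bound on almost all individual present values carries over to the average. -/
theorem IsIntegrableProfile.average_budget (h : IsIntegrableProfile μ c)
    (h0 : ∀ᵐ i ∂μ, ∀ᵐ t ∂volume.restrict (Ici (0 : ℝ)), 0 ≤ c i t) {b : ℝ}
    (hb : ∀ᵐ i ∂μ, E.HasPresentValue (c i) ∧ E.presentValue (c i) ≤ b) :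
    E.HasPresentValue (averageConsumption μ c) ∧ E.presentValue (averageConsumption μ c) ≤ b := by
  -- Fubini is applied on finite horizons, where the profile is integrable by definition;
  -- nonnegativity of the average handles the limit.
  refine hasPresentValue_of_integral_le h.locallyIntegrableOn_averageConsumption
    (h.averageConsumption_nonneg h0) fun T hT => ?_
  have hint := h.integrable_exp_mul (E := E) T
  have hle : ∀ᵐ i ∂μ, ∫ t in Icc (0 : ℝ) T, Real.exp (-(E.netReturn * t)) * c i t ≤ b := by
    filter_upwards [h0, hb] with i hi0 hib
    have := hib.1.integral_le hi0 hT
    rw [intervalIntegral.integral_of_le hT, ← integral_Icc_eq_integral_Ioc] at this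
    exact this.trans hib.2
  calc ∫ u in (0 : ℝ)..T, Real.exp (-(E.netReturn * u)) * averageConsumption μ c u
      = ∫ t in Icc (0 : ℝ) T, ∫ i, Real.exp (-(E.netReturn * t)) * c i t ∂μ := by
        rw [intervalIntegral.integral_of_le hT, ← integral_Icc_eq_integral_Ioc]
        simp only [integral_const_mul, averageConsumption]
    _ = ∫ i, (∫ t in Icc (0 : ℝ) T, Real.exp (-(E.netReturn * t)) * c i t) ∂μ :=
        (integral_integral_swap hint).symm
    _ ≤ ∫ _, b ∂μ := integral_mono_ae hint.integral_prod_left (integrable_const b) hle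
    _ = b := by simp

/-- For nonnegative consumption the mean of the absolute value is the average itself, so a finite
aggregate present value gives integrability on all of `Ω × [0, ∞)`. -/
theorem IsIntegrableProfile.integrable_prod_exp_mul (h : IsIntegrableProfile μ c)
    (h0 : ∀ᵐ i ∂μ, ∀ᵐ t ∂volume.restrict (Ici (0 : ℝ)), 0 ≤ c i t)
    (hpv : E.HasPresentValue (averageConsumption μ c)) :
    Integrable (Function.uncurry fun i t => Real.exp (-(E.netReturn * t)) * c i t)
      (μ.prod (volume.restrict (Ici (0 : ℝ)))) := by
  have hcont : Continuous fun t => Real.exp (-(E.netReturn * t)) := by fun_prop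
  have hm : AEStronglyMeasurable
      (Function.uncurry fun i t => Real.exp (-(E.netReturn * t)) * c i t)
      (μ.prod (volume.restrict (Ici (0 : ℝ)))) :=
    hcont.aestronglyMeasurable.comp_snd.mul h.aestronglyMeasurable
  rw [integrable_prod_iff' hm]
  constructor
  · filter_upwards [h.ae_integrable] with t ht
    exact ht.const_mul (Real.exp (-(E.netReturn * t)))
  · refine Integrable.congr hpv ?_
    filter_upwards [h.ae_ae_nonneg h0] with t ht
    rw [averageConsumption, ← integral_const_mul]
    refine integral_congr_ae ?_
    filter_upwards [ht] with i hi
    exact (Real.norm_of_nonneg (mul_nonneg (Real.exp_pos _).le hi)).symm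

theorem IsIntegrableProfile.ae_hasPresentValue (h : IsIntegrableProfile μ c)
    (h0 : ∀ᵐ i ∂μ, ∀ᵐ t ∂volume.restrict (Ici (0 : ℝ)), 0 ≤ c i t)
    (hpv : E.HasPresentValue (averageConsumption μ c)) : ∀ᵐ i ∂μ, E.HasPresentValue (c i) :=
  (h.integrable_prod_exp_mul h0 hpv).prod_right_ae

theorem IsIntegrableProfile.integrable_presentValue (h : IsIntegrableProfile μ c)
    (h0 : ∀ᵐ i ∂μ, ∀ᵐ t ∂volume.restrict (Ici (0 : ℝ)), 0 ≤ c i t)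
    (hpv : E.HasPresentValue (averageConsumption μ c)) :
    Integrable (fun i => E.presentValue (c i)) μ :=
  (h.integrable_prod_exp_mul h0 hpv).integral_prod_left

theorem IsIntegrableProfile.integral_presentValue (h : IsIntegrableProfile μ c)
    (h0 : ∀ᵐ i ∂μ, ∀ᵐ t ∂volume.restrict (Ici (0 : ℝ)), 0 ≤ c i t)
    (hpv : E.HasPresentValue (averageConsumption μ c)) :
    ∫ i, E.presentValue (c i) ∂μ = E.presentValue (averageConsumption μ c) := by
  refine (integral_integral_swap (h.integrable_prod_exp_mul h0 hpv)).trans ?_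
  simp only [integral_const_mul, presentValue, averageConsumption]

end Population

/-! ### The household problem as a budget for excess consumption. -/

section Household

variable {E : HabitEconomy} {R : HabitRegime} {cbar c k : ℝ → ℝ} {B : ℝ}

/-- Every admissible path has excess consumption of present value at most `B`. -/
def ExcessBudget (E : HabitEconomy) (R : HabitRegime) (cbar : ℝ → ℝ) (B : ℝ) : Prop :=
  ∀ c k : ℝ → ℝ, E.IsAdmissible (E.habit (R.customary cbar c)) c k →
    E.HasPresentValue (fun t => c t - E.habit (R.customary cbar c) t) ∧
      E.presentValue (fun t => c t - E.habit (R.customary cbar c) t) ≤ B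

theorem IsAdmissible.budget {h : ℝ → ℝ} (hadm : E.IsAdmissible h c k) :
    E.HasPresentValue c ∧ E.presentValue c ≤ E.k₀ :=
  hadm.capitalPath.budget hadm.locallyIntegrable hadm.consumption_nonneg hadm.capital_nonneg

/-- The excess has present value `(1 - D) PV(c) - H`, which increases with `PV(c) ≤ k₀` because `D <
1`. -/
theorem excessBudget_internal (hε : 0 ≤ E.ε) (hτ : 0 ≤ E.τ)
    (hc₀ : IntegrableOn E.c₀ (Ico (-E.τ) 0)) (hD : E.habitShare < 1) (cbar : ℝ → ℝ) :
    E.ExcessBudget .internal cbar E.initialG := by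
  intro c k hadm
  obtain ⟨hc, hck⟩ := hadm.budget
  have hh := hasPresentValue_habit hε hτ hc₀ hc
  refine ⟨hc.sub hh, ?_⟩
  change E.presentValue (fun t => c t - E.habit c t) ≤ _
  rw [presentValue_sub hc hh, presentValue_habit hε hτ hc₀ hc, initialG_eq]
  nlinarith

theorem excessBudget_external (hh : E.HasPresentValue (E.habit cbar)) :
    E.ExcessBudget .external cbar (E.k₀ - E.presentValue (E.habit cbar)) := by
  intro c k hadm
  obtain ⟨hc, hck⟩ := hadm.budget
  refine ⟨hc.sub hh, ?_⟩
  change E.presentValue (fun t => c t - E.habit cbar t) ≤ _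
  rw [presentValue_sub hc hh]
  linarith

/-- Any path with the optimal excess attains `optimalUtility B`, while the tangent bound with its
positive multiplier keeps every competitor within the budget at or below it. -/
theorem ExcessBudget.isHouseholdOptimal
    (hγ : 0 < E.γ) (hγ1 : E.γ ≠ 1) (hρ : E.netReturn * (1 - E.γ) < E.ρ) (hB : 0 < B)
    (hbud : E.ExcessBudget R cbar B)
    (hc : E.HasPresentValue c) (hc0 : ∀ᵐ t ∂volume.restrict (Ici (0 : ℝ)), 0 ≤ c t)
    (hck : E.presentValue c ≤ E.k₀)
    (hx : (fun t => c t - E.habit (R.customary cbar c) t)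
      =ᵐ[volume.restrict (Ici (0 : ℝ))] E.optimalExcess B) :
    E.IsHouseholdOptimal R cbar c (E.capital c) := by
  have hU := lifetimeUtility_of_ae_eq_optimalExcess hγ hρ hB hx
  refine ⟨⟨hc.locallyIntegrableOn, hc0, isCapitalPath_capital hc.locallyIntegrableOn,
    fun t ht => capital_nonneg hc hc0 hck ht, ?_⟩, ?_, ?_, fun c' k' hadm => ?_⟩
  · filter_upwards [hx] with t ht
    linarith [optimalExcess_pos hγ hρ hB t]
  · rw [hU]
    exact EReal.coe_ne_bot _
  · rw [hU]
    exact EReal.coe_ne_top _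
  · obtain ⟨h1, h2⟩ := hbud c' k' hadm
    rw [hU]
    refine (lifetimeUtility_le hγ hγ1 hρ hB h1).trans (EReal.coe_le_coe_iff.2 ?_)
    have ha := Real.rpow_pos_of_pos (mul_pos (sub_pos.2 (growth_lt_netReturn hγ hρ)) hB) (-E.γ)
    nlinarith

/-- If the budget can be exhausted optimally, then every optimum does so. -/
theorem ExcessBudget.excess_ae_eq
    (hγ : 0 < E.γ) (hγ1 : E.γ ≠ 1) (hρ : E.netReturn * (1 - E.γ) < E.ρ) (hB : 0 < B)
    (hbud : E.ExcessBudget R cbar B)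
    (hopt : E.IsHouseholdOptimal R cbar c k) {c' k' : ℝ → ℝ}
    (hopt' : E.IsHouseholdOptimal R cbar c' k')
    (hx : (fun t => c' t - E.habit (R.customary cbar c') t)
      =ᵐ[volume.restrict (Ici (0 : ℝ))] E.optimalExcess B) :
    (fun t => c t - E.habit (R.customary cbar c) t)
      =ᵐ[volume.restrict (Ici (0 : ℝ))] E.optimalExcess B := by
  obtain ⟨h1, h2⟩ := hbud c k hopt.admissible
  refine ae_eq_optimalExcess hγ hγ1 hρ hB h1 h2 ?_
  rw [← lifetimeUtility_of_ae_eq_optimalExcess hγ hρ hB hx]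
  exact hopt.le_of_admissible c' k' hopt'.admissible

theorem capital_congr {c c' : ℝ → ℝ} (h : c =ᵐ[volume.restrict (Ici (0 : ℝ))] c') :
    EqOn (E.capital c) (E.capital c') (Ici 0) := by
  intro t ht
  rw [capital, capital, intervalIntegral.integral_of_le ht, intervalIntegral.integral_of_le ht]
  congr 2
  refine integral_congr_ae ?_
  filter_upwards [ae_restrict_of_ae_restrict_of_subset
    (Ioc_subset_Icc_self.trans Icc_subset_Ici_self : Ioc (0 : ℝ) t ⊆ Ici 0) h] with u hu
  rw [hu]

end Household

end HabitEconomy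

/-! ### Uniqueness of equilibrium and Pareto optimality. -/

namespace HabitEconomy

section Equilibrium

variable {E : HabitEconomy} {R : HabitRegime} {Ω : Type*} [MeasurableSpace Ω] {μ : Measure Ω}
  {c k : Ω → ℝ → ℝ} {d : ℝ → ℝ}

theorem IsEquilibrium.ae_nonneg (heq : E.IsEquilibrium R μ c k) :
    ∀ᵐ i ∂μ, ∀ᵐ t ∂volume.restrict (Ici (0 : ℝ)), 0 ≤ c i t :=
  heq.optimal.mono fun _ hi => hi.admissible.consumption_nonneg

variable [IsProbabilityMeasure μ]

/-- Consumption whose excess over own habits is optimal for the initial wealth net of habits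
exhausts the initial capital. -/
theorem presentValue_eq_capital (hγ : 0 < E.γ) (hρ : E.netReturn * (1 - E.γ) < E.ρ)
    (hε : 0 ≤ E.ε) (hτ : 0 ≤ E.τ) (hc₀ : IntegrableOn E.c₀ (Ico (-E.τ) 0))
    (hD : E.habitShare < 1) (hd : E.HasPresentValue d)
    (hx : (fun t => d t - E.habit d t)
      =ᵐ[volume.restrict (Ici (0 : ℝ))] E.optimalExcess E.initialG) :
    E.presentValue d = E.k₀ := by
  have h1 := presentValue_congr (E := E) hx
  rw [presentValue_sub hd (hasPresentValue_habit hε hτ hc₀ hd), presentValue_habit hε hτ hc₀ hd,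
    presentValue_optimalExcess hγ hρ, initialG_eq] at h1
  have h2 : (1 - E.habitShare) * (E.presentValue d - E.k₀) = 0 := by linear_combination h1
  exact sub_eq_zero.1 ((mul_eq_zero.1 h2).resolve_left (sub_pos.2 hD).ne')

/-- When average consumption exhausts the initial capital, the budgets for excess consumption
coincide under both regimes. -/
theorem excessBudget_of_presentValue_eq (hε : 0 ≤ E.ε) (hτ : 0 ≤ E.τ)
    (hc₀ : IntegrableOn E.c₀ (Ico (-E.τ) 0)) (hD : E.habitShare < 1) (hd : E.HasPresentValue d)
    (hdk : E.presentValue d = E.k₀) (R : HabitRegime) : E.ExcessBudget R d E.initialG := by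
  cases R with
  | internal => exact excessBudget_internal hε hτ hc₀ hD d
  | external =>
    have h := excessBudget_external (hasPresentValue_habit hε hτ hc₀ hd)
    rwa [presentValue_habit hε hτ hc₀ hd, hdk,
      show E.k₀ - (E.habitShare * E.k₀ + E.historyValue) = E.initialG by
        rw [initialG_eq]
        ring] at h

/-- In an equilibrium with external habits, almost all households follow the path which solves
the problem with internal habits. -/
theorem IsEquilibrium.ae_eq_of_external (hγ : 0 < E.γ) (hγ1 : E.γ ≠ 1)
    (hρ : E.netReturn * (1 - E.γ) < E.ρ) (hε : 0 ≤ E.ε) (hτ : 0 ≤ E.τ)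
    (hc₀ : IntegrableOn E.c₀ (Ico (-E.τ) 0))
    (hc₀_nonneg : ∀ᵐ s ∂volume.restrict (Ico (-E.τ) 0), 0 ≤ E.c₀ s) (hD : E.habitShare < 1)
    (hD0 : 0 ≤ E.habitShare)
    (hG : 0 < E.initialG) (heq : E.IsEquilibrium .external μ c k) (hd : E.HasPresentValue d)
    (hx : (fun t => d t - E.habit d t)
      =ᵐ[volume.restrict (Ici (0 : ℝ))] E.optimalExcess E.initialG) :
    ∀ᵐ i ∂μ, c i =ᵐ[volume.restrict (Ici (0 : ℝ))] d := by
  set cbar := averageConsumption μ c with hcbar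
  have h0 := heq.ae_nonneg
  obtain ⟨hbar, hbark⟩ := heq.integrable.average_budget (E := E) h0
    (heq.optimal.mono fun _ hi => hi.admissible.budget)
  rw [← hcbar] at hbar hbark
  have hbar0 := heq.integrable.averageConsumption_nonneg h0
  have hh := hasPresentValue_habit hε hτ hc₀ hbar
  have hhpv := presentValue_habit hε hτ hc₀ hbar
  set B := E.k₀ - E.presentValue (E.habit cbar) with hBdef
  -- Here `B = k₀ - D · PV(c̄) - H ≥ initialG`, since `PV(c̄) ≤ k₀` and `D ≥ 0`.
  have hB : 0 < B := by
    rw [initialG_eq] at hG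
    nlinarith
  have hbud : E.ExcessBudget .external cbar B := excessBudget_external hh
  -- The best response to `c̄`: the given habit plus the optimal excess. It costs exactly `k₀`, and
  -- all households must choose it.
  set e : ℝ → ℝ := fun t => E.habit cbar t + E.optimalExcess B t with he
  have hxpv := hasPresentValue_optimalExcess hγ hρ B
  have hepv : E.HasPresentValue e := hh.add hxpv
  have hek : E.presentValue e = E.k₀ := by
    rw [he, presentValue_add hh hxpv, presentValue_optimalExcess hγ hρ, hBdef]
    ring
  have he0 : ∀ᵐ t ∂volume.restrict (Ici (0 : ℝ)), 0 ≤ e t := by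
    refine (ae_restrict_iff' measurableSet_Ici).2 (Eventually.of_forall fun t ht => ?_)
    exact add_nonneg (habit_nonneg hε hτ hc₀_nonneg hbar0 ht) (optimalExcess_pos hγ hρ hB t).le
  have hex : (fun t => e t - E.habit (HabitRegime.external.customary cbar e) t)
      =ᵐ[volume.restrict (Ici (0 : ℝ))] E.optimalExcess B :=
    Eventually.of_forall fun t => add_sub_cancel_left (E.habit cbar t) _
  have hopt := hbud.isHouseholdOptimal hγ hγ1 hρ hB hepv he0 hek.le hex
  have hce : ∀ᵐ i ∂μ, c i =ᵐ[volume.restrict (Ici (0 : ℝ))] e := by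
    filter_upwards [heq.optimal] with i hi
    filter_upwards [hbud.excess_ae_eq hγ hγ1 hρ hB hi hopt hex] with t ht
    exact sub_eq_iff_eq_add'.1 ht
  have hbare := heq.integrable.averageConsumption_ae_eq hepv.aemeasurable hce
  -- Consistency closes the loop: the average equals `e`, which exhausts `k₀`, so the external
  -- budget becomes the internal one.
  have hBG : B = E.initialG := by
    rw [hBdef, hhpv, presentValue_congr hbare, hek, initialG_eq]
    ring
  have hexG : (fun t => e t - E.habit e t)
      =ᵐ[volume.restrict (Ici (0 : ℝ))] E.optimalExcess E.initialG := by
    refine (ae_restrict_iff' measurableSet_Ici).2 (Eventually.of_forall fun t ht => ?_)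
    change e t - E.habit e t = _
    rw [← habit_congr hτ hbare ht, ← hBG]
    exact add_sub_cancel_left (E.habit cbar t) _
  have hed := consumption_unique hε hτ hc₀ hD hepv hd hexG hx
  exact hce.mono fun i hi => hi.trans hed

/-- In an equilibrium, almost all households follow the path which solves the problem with
internal habits. -/
theorem IsEquilibrium.ae_eq (hγ : 0 < E.γ) (hγ1 : E.γ ≠ 1)
    (hρ : E.netReturn * (1 - E.γ) < E.ρ) (hε : 0 ≤ E.ε) (hτ : 0 ≤ E.τ)
    (hc₀ : IntegrableOn E.c₀ (Ico (-E.τ) 0))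
    (hc₀_nonneg : ∀ᵐ s ∂volume.restrict (Ico (-E.τ) 0), 0 ≤ E.c₀ s) (hD : E.habitShare < 1)
    (hD0 : 0 ≤ E.habitShare)
    (hG : 0 < E.initialG) (heq : E.IsEquilibrium R μ c k) (hd : E.HasPresentValue d)
    (hd0 : ∀ᵐ t ∂volume.restrict (Ici (0 : ℝ)), 0 ≤ d t)
    (hx : (fun t => d t - E.habit d t)
      =ᵐ[volume.restrict (Ici (0 : ℝ))] E.optimalExcess E.initialG) :
    ∀ᵐ i ∂μ, c i =ᵐ[volume.restrict (Ici (0 : ℝ))] d := by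
  cases R with
  | internal =>
    have hdk := presentValue_eq_capital hγ hρ hε hτ hc₀ hD hd hx
    have hbud := excessBudget_internal hε hτ hc₀ hD (averageConsumption μ c)
    have hx' : (fun t => d t -
        E.habit (HabitRegime.internal.customary (averageConsumption μ c) d) t)
        =ᵐ[volume.restrict (Ici (0 : ℝ))] E.optimalExcess E.initialG := hx
    have hopt := hbud.isHouseholdOptimal hγ hγ1 hρ hG hd hd0 hdk.le hx'
    filter_upwards [heq.optimal] with i hi
    have hxi := hbud.excess_ae_eq hγ hγ1 hρ hG hi hopt hx'
    exact consumption_unique hε hτ hc₀ hD hi.admissible.budget.1 hd hxi hx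
  | external =>
    exact heq.ae_eq_of_external hγ hγ1 hρ hε hτ hc₀ hc₀_nonneg hD hD0 hG hd hx

/-- In a feasible profile, the individual present values of excess consumption exist, and their
average is at most the initial wealth net of habits. -/
theorem IsFeasible.excess_presentValue (hε : 0 ≤ E.ε) (hτ : 0 ≤ E.τ)
    (hc₀ : IntegrableOn E.c₀ (Ico (-E.τ) 0)) (hD : E.habitShare < 1)
    (hfeas : E.IsFeasible μ c) (R : HabitRegime) :
    ∃ X : Ω → ℝ, Integrable X μ ∧ ∫ i, X i ∂μ ≤ E.initialG ∧ ∀ᵐ i ∂μ,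
      E.HasPresentValue
        (fun t => c i t - E.habit (R.customary (averageConsumption μ c) (c i)) t) ∧
      E.presentValue
        (fun t => c i t - E.habit (R.customary (averageConsumption μ c) (c i)) t) = X i := by
  obtain ⟨K, hK, hK0⟩ := hfeas.resources
  have h0 := hfeas.nonneg
  have hint := hfeas.integrable
  obtain ⟨hbar, hbark⟩ := hK.budget hint.locallyIntegrableOn_averageConsumption
    (hint.averageConsumption_nonneg h0) hK0
  have hX := hint.integrable_presentValue h0 hbar
  have hXint := hint.integral_presentValue h0 hbar
  have hpv := hint.ae_hasPresentValue h0 hbar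
  -- The left side is the average of the individual excess values in both regimes: habits are linear
  -- in consumption, so own and average habits aggregate alike.
  have hle : (1 - E.habitShare) * E.presentValue (averageConsumption μ c) - E.historyValue ≤
      E.initialG := by
    rw [initialG_eq]
    nlinarith
  cases R with
  | internal =>
    refine ⟨fun i => (1 - E.habitShare) * E.presentValue (c i) - E.historyValue,
      (hX.const_mul _).sub (integrable_const _), ?_, ?_⟩
    · rw [integral_sub (hX.const_mul _) (integrable_const _), integral_const_mul, hXint]
      simpa using hle
    · filter_upwards [hpv] with i hi
      have hh := hasPresentValue_habit hε hτ hc₀ hi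
      refine ⟨hi.sub hh, (presentValue_sub hi hh).trans ?_⟩
      rw [presentValue_habit hε hτ hc₀ hi]
      ring
  | external =>
    have hh := hasPresentValue_habit hε hτ hc₀ hbar
    refine ⟨fun i => E.presentValue (c i) - E.presentValue (E.habit (averageConsumption μ c)),
      hX.sub (integrable_const _), ?_, ?_⟩
    · rw [integral_sub hX (integrable_const _), hXint, presentValue_habit hε hτ hc₀ hbar]
      simp only [integral_const, probReal_univ, one_smul]
      linarith
    · filter_upwards [hpv] with i hi
      exact ⟨hi.sub hh, presentValue_sub hi hh⟩

/-- A weakly improving profile needs `X i ≥ initialG` for almost every household, by the affine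
utility bound. As the mean of `X` is at most `initialG`, equality holds a.e., and then the same
bound excludes any strict gain. -/
theorem isParetoOptimal_const (hγ : 0 < E.γ) (hγ1 : E.γ ≠ 1)
    (hρ : E.netReturn * (1 - E.γ) < E.ρ) (hε : 0 ≤ E.ε) (hτ : 0 ≤ E.τ)
    (hc₀ : IntegrableOn E.c₀ (Ico (-E.τ) 0)) (hD : E.habitShare < 1)
    (hG : 0 < E.initialG) (hd : E.HasPresentValue d)
    (hd0 : ∀ᵐ t ∂volume.restrict (Ici (0 : ℝ)), 0 ≤ d t)
    (hx : (fun t => d t - E.habit d t)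
      =ᵐ[volume.restrict (Ici (0 : ℝ))] E.optimalExcess E.initialG) (R : HabitRegime) :
    E.IsParetoOptimal R μ (fun _ => d) := by
  have hdk := presentValue_eq_capital hγ hρ hε hτ hc₀ hD hd hx
  refine ⟨⟨isIntegrableProfile_const hd.locallyIntegrableOn, Eventually.of_forall fun _ => hd0,
    E.capital d, ?_, fun t ht => capital_nonneg hd hd0 hdk.le ht⟩, ?_⟩
  · rw [averageConsumption_const]
    exact isCapitalPath_capital hd.locallyIntegrableOn
  rintro ⟨c, hfeas, hge, hgt⟩
  have hU : ∀ i, E.profileUtility R μ (fun _ => d) i = (E.optimalUtility E.initialG : EReal) := by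
    intro i
    have hcust : R.customary d d = d := by cases R <;> rfl
    rw [profileUtility, averageConsumption_const, hcust]
    exact lifetimeUtility_of_ae_eq_optimalExcess hγ hρ hG hx
  obtain ⟨X, hX, hXG, hXpv⟩ := hfeas.excess_presentValue hε hτ hc₀ hD R
  have ha := Real.rpow_pos_of_pos (mul_pos (sub_pos.2 (growth_lt_netReturn hγ hρ)) hG) (-E.γ)
  have hbound : ∀ᵐ i ∂μ, E.profileUtility R μ c i ≤ ((E.optimalUtility E.initialG +
      ((E.netReturn - E.growth) * E.initialG) ^ (-E.γ) * (X i - E.initialG) : ℝ) : EReal) := by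
    filter_upwards [hXpv] with i hi
    rw [← hi.2]
    exact lifetimeUtility_le hγ hγ1 hρ hG hi.1
  have hnonneg : ∀ᵐ i ∂μ, 0 ≤ X i - E.initialG := by
    filter_upwards [hge, hbound] with i h1 h2
    rw [hU] at h1
    have h3 := EReal.coe_le_coe_iff.1 (h1.trans h2)
    exact nonneg_of_mul_nonneg_right (by linarith) ha
  have hzero : ∀ᵐ i ∂μ, X i - E.initialG = 0 := by
    have hint := hX.sub (integrable_const (μ := μ) E.initialG)
    refine (integral_eq_zero_iff_of_nonneg_ae hnonneg hint).1 (le_antisymm ?_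
      (integral_nonneg_of_ae hnonneg))
    rw [integral_sub hX (integrable_const _)]
    simpa using hXG
  refine hgt ?_
  filter_upwards [hbound, hzero] with i h1 h2
  rw [hU, not_lt]
  simpa [h2] using h1

end Equilibrium

end HabitEconomy

/-! ### The equivalence theorem. -/

theorem mainTheorem1 (E : HabitEconomy)
    (hγ : 0 < E.γ) (hγ1 : E.γ ≠ 1)
    (hε : 0 ≤ E.ε) (hη : 0 ≤ E.η) (hτ : 0 ≤ E.τ)
    (hk₀ : 0 < E.k₀)
    (hc₀ : IntegrableOn E.c₀ (Ico (-E.τ) 0))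
    (hc₀_nonneg : ∀ᵐ s ∂volume.restrict (Ico (-E.τ) 0), 0 ≤ E.c₀ s)
    (hroot : ∀ lam : ℝ, E.IsCharacteristicRoot lam → lam < E.A - E.δ)
    (hρ : (E.A - E.δ) * (1 - E.γ) < E.ρ)
    (hG : 0 < E.initialG)
    {Ω : Type*} [MeasurableSpace Ω] (μ : Measure Ω) [IsProbabilityMeasure μ] :
    ∃ cstar kstar : ℝ → ℝ, ∀ R : HabitRegime,
      E.IsEquilibrium R μ (fun _ => cstar) (fun _ => kstar) ∧
      (∀ c k : Ω → ℝ → ℝ, E.IsEquilibrium R μ c k →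
        ∀ᵐ i ∂μ, c i =ᵐ[volume.restrict (Ici (0 : ℝ))] cstar ∧ EqOn (k i) kstar (Ici 0)) ∧
      E.IsParetoOptimal R μ (fun _ => cstar) := by
  have hD := HabitEconomy.habitShare_lt_one hε hroot
  have hD0 : 0 ≤ E.habitShare := by
    rw [← HabitEconomy.integral_habitKernel hτ]
    exact integral_nonneg (HabitEconomy.habitKernel_nonneg hε)
  -- The common path solves the internal problem; since it exhausts `k₀`, its external budget taken
  -- at itself is also `initialG`, so it serves both regimes.
  obtain ⟨d, hd, hd0, hx⟩ := HabitEconomy.exists_consumption hε hτ hc₀ hc₀_nonneg hD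
    (HabitEconomy.hasPresentValue_optimalExcess hγ hρ E.initialG)
    (fun t => (HabitEconomy.optimalExcess_pos hγ hρ hG t).le)
  have hdk := HabitEconomy.presentValue_eq_capital hγ hρ hε hτ hc₀ hD hd hx
  refine ⟨d, E.capital d, fun R => ⟨⟨?_, Eventually.of_forall fun _ => ?_⟩, fun c k heq => ?_,
    HabitEconomy.isParetoOptimal_const hγ hγ1 hρ hε hτ hc₀ hD hG hd hd0 hx R⟩⟩
  · exact HabitEconomy.isIntegrableProfile_const hd.locallyIntegrableOn
  · rw [HabitEconomy.averageConsumption_const]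
    have hcust : R.customary d d = d := by cases R <;> rfl
    exact (HabitEconomy.excessBudget_of_presentValue_eq hε hτ hc₀ hD hd hdk R).isHouseholdOptimal
      hγ hγ1 hρ hG hd hd0 hdk.le (by rwa [hcust])
  · filter_upwards [heq.ae_eq hγ hγ1 hρ hε hτ hc₀ hc₀_nonneg hD hD0 hG hd hd0 hx, heq.optimal]
      with i hi hopt
    exact ⟨hi, (hopt.admissible.capitalPath.eqOn_capital
      hopt.admissible.locallyIntegrable).trans (HabitEconomy.capital_congr hi)⟩
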